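/- Let $\mathbb X,\mathbb Y$ be finite alphabets, $p_0$ a PMF on $\mathbb X$ (the source) and $p_{Y|X}$ a conditional PMF; write $p_{X,Y}(x,y)=p_0(x)p_{Y|X}(y|x)$ and $\|p-q\|_{TV}=\frac12\sum|p-q|$. Rates are in nats. An $(e^{nR_1},e^{nR_2},n)$ coordination code consists of two encoders $i_k:\mathbb X^n\to\{1,\dots,\lfloor e^{nR_k}\rfloor\}$, $k=1,2$, and three decoders $y_k^n:\{1,\dots,\lfloor e^{nR_k}\rfloor\}\to\mathbb Y^n$, $k=1,2$, and $y_{12}^n:\{1,\dots,\lfloor e^{nR_1}\rfloor\}\times\{1,\dots,\lfloor e^{nR_2}\rfloor\}\to\mathbb Y^n$. The tuple $(R_1,R_2,\Delta_1,\Delta_2,\Delta_{12})\in\mathbb R^5$ is achievable for $p_{X,Y}$ if there is an $N$ such that for every $n>N$ there is such a code for which, with $X^n$ i.i.d. $\sim p_0$, the joint type (empirical PMF) $P_{X^n,Y^n}$ of $X^n$ and the decoder output $Y^n$ satisfies $\mathbb E\|P_{X^n,Y^n}-p_{X,Y}\|_{TV}\le\Delta_i$ for each $i=1,2,12$, where $Y^n$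 is $y_1^n(i_1(X^n))$, $y_2^n(i_2(X^n))$, $y_{12}^n(i_1(X^n),i_2(X^n))$ for $i=1,2,12$ respectively. Let $R^I_{p_0}(p_{Y|X})$ be the closure in $\mathbb R^5$ of the set of achievable tuples. Theorem. For every finite set $\mathbb U$ and every conditional PMF $p_{U,\hat Y^{(1)},\hat Y^{(2)},\hat Y^{(12)}|X}$ from $\mathbb X$ to $\mathbb U\times\mathbb Y^3$, every tuple $(R_1,R_2,\Delta_1,\Delta_2,\Delta_{12})$ with $$\|p_{X,Y}-p_0\,p_{\hat Y^{(i)}|X}\|_{TV}\le\Delta_i,\qquad i=1,2,12,$$ and $$R_1\ge I(X;\hat Y^{(1)},U),\qquad R_2\ge I(X;\hat Y^{(2)},U),$$ $$R_1+R_2\ge I(X;U)+I(X;\hat Y^{(1)},\hat Y^{(2)},\hat Y^{(12)},U)+I(\hat Y^{(1)};\hat Y^{(2)}|U),$$ the mutual informations being computed under $p_0\,p_{U,\hat Y^{(1)},\hat Y^{(2)},\hat Y^{(12)}|X}$, belongs to $R^I_{p_0}(p_{Y|X})$. -/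

import Mathlib

/-!
Finite-alphabet probability mass functions are the elements of `stdSimplex ℝ α`; a conditional
PMF from `α` to `β` is a map `κ : α → β → ℝ` with `κ a ∈ stdSimplex ℝ β` for every `a`.
Logarithms are natural and rates are in nats.
-/

universe u v w

namespace MDCoord

noncomputable section

open Classical in
/-- The law of the random variable `f` under the PMF `P` on `Ω` (a marginal of `P`). -/
def law {Ω A : Type*} [Fintype Ω] (P : Ω → ℝ) (f : Ω → A) (a : A) : ℝ :=
  ∑ ω with f ω = a, P ω

/-- The joint PMF `p(a) κ(b|a)`. -/
def jointPMF {A B : Type*} (p : A → ℝ) (κ : A → B → ℝ) (z : A × B) : ℝ :=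
  p z.1 * κ z.1 z.2

/-- Mutual information `I(f; g)` of two random variables on the finite space `(Ω, P)`.
Terms with joint probability zero vanish. -/
def mutualInfo {Ω A B : Type*} [Fintype Ω] [Fintype A] [Fintype B]
    (P : Ω → ℝ) (f : Ω → A) (g : Ω → B) : ℝ :=
  ∑ a, ∑ b, law P (fun ω => (f ω, g ω)) (a, b) *
    Real.log (law P (fun ω => (f ω, g ω)) (a, b) / (law P f a * law P g b))

/-- Conditional mutual information `I(f; g | h)` of random variables on `(Ω, P)`:
`∑ p(a,b,c) log (p(a,b,c) p(c) / (p(a,c) p(b,c)))`. -/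
def condMutualInfo {Ω A B C : Type*} [Fintype Ω] [Fintype A] [Fintype B] [Fintype C]
    (P : Ω → ℝ) (f : Ω → A) (g : Ω → B) (h : Ω → C) : ℝ :=
  ∑ a, ∑ b, ∑ c, law P (fun ω => (f ω, g ω, h ω)) (a, b, c) *
    Real.log (law P (fun ω => (f ω, g ω, h ω)) (a, b, c) * law P h c /
      (law P (fun ω => (f ω, h ω)) (a, c) * law P (fun ω => (g ω, h ω)) (b, c)))

/-- Total variation `‖p - q‖_TV = (1/2) ∑ |p - q|`. -/
def tv {A : Type*} [Fintype A] (p q : A → ℝ) : ℝ :=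
  (1 / 2) * ∑ a, |p a - q a|

/-- The `Δ`-neighborhood of the PMF `p`. -/
def nbhd {A : Type*} [Fintype A] (Δ : ℝ) (p : A → ℝ) : Set (A → ℝ) :=
  {q | q ∈ stdSimplex ℝ A ∧ tv p q ≤ Δ}

open Classical in
/-- The joint type (empirical PMF) of two sequences of length `n`. -/
def jointType {X Y : Type*} {n : ℕ} (x : Fin n → X) (y : Fin n → Y) (z : X × Y) : ℝ :=
  (1 / (n : ℝ)) * ∑ i, if (x i, y i) = z then 1 else 0

/-- The number of messages `⌊e^{nR}⌋` of a link of rate `R` at blocklength `n`. -/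
def numMessages (n : ℕ) (R : ℝ) : ℕ := ⌊Real.exp (n * R)⌋₊

/-- An `(e^{nR₁}, e^{nR₂}, n)` coordination code: two encoders and three decoders. -/
structure CoordinationCode (X Y : Type*) (R₁ R₂ : ℝ) (n : ℕ) where
  enc₁ : (Fin n → X) → Fin (numMessages n R₁)
  enc₂ : (Fin n → X) → Fin (numMessages n R₂)
  dec₁ : Fin (numMessages n R₁) → (Fin n → Y)
  dec₂ : Fin (numMessages n R₂) → (Fin n → Y)
  dec₁₂ : Fin (numMessages n R₁) × Fin (numMessages n R₂) → (Fin n → Y)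

/-- The expectation, for `Xⁿ` i.i.d. with PMF `p₀` and `Yⁿ = φ(Xⁿ)`, of the total variation
between the joint type of `(Xⁿ, Yⁿ)` and the desired PMF `q`. -/
def expectedTV {X Y : Type*} [Fintype X] [Fintype Y] (p₀ : X → ℝ) (q : X × Y → ℝ) {n : ℕ}
    (φ : (Fin n → X) → (Fin n → Y)) : ℝ :=
  ∑ x : Fin n → X, (∏ i, p₀ (x i)) * tv (jointType x (φ x)) q

/-- `p₀(x) W(y|x)` is achievable for `Δ₁Δ₂Δ₁₂`-empirical coordination at rates `(R₁, R₂)`. -/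
def Achievable {X Y : Type*} [Fintype X] [Fintype Y] (p₀ : X → ℝ) (W : X → Y → ℝ)
    (R₁ R₂ Δ₁ Δ₂ Δ₁₂ : ℝ) : Prop :=
  ∃ N : ℕ, ∀ n : ℕ, N < n → ∃ c : CoordinationCode X Y R₁ R₂ n,
    expectedTV p₀ (jointPMF p₀ W) (fun x => c.dec₁ (c.enc₁ x)) ≤ Δ₁ ∧
    expectedTV p₀ (jointPMF p₀ W) (fun x => c.dec₂ (c.enc₂ x)) ≤ Δ₂ ∧
    expectedTV p₀ (jointPMF p₀ W) (fun x => c.dec₁₂ (c.enc₁ x, c.enc₂ x)) ≤ Δ₁₂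

/-- The multiple-rate-distortion-coordination region: the closure in `ℝ⁵` of the set of
achievable tuples `(R₁, R₂, Δ₁, Δ₂, Δ₁₂)`. -/
def coordinationRegion {X Y : Type*} [Fintype X] [Fintype Y] (p₀ : X → ℝ) (W : X → Y → ℝ) :
    Set (ℝ × ℝ × ℝ × ℝ × ℝ) :=
  closure {(R₁, R₂, Δ₁, Δ₂, Δ₁₂) : ℝ × ℝ × ℝ × ℝ × ℝ | Achievable p₀ W R₁ R₂ Δ₁ Δ₂ Δ₁₂}

/-- The tuples `(R₁, R₂, Δ₁, Δ₂, Δ₁₂)` whose rates satisfy, for the joint PMF `P` of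
`(X, (U, Ŷ⁽¹⁾, Ŷ⁽²⁾, Ŷ⁽¹²⁾))`, the three superposition-coding rate inequalities. -/
def rateRegion {X U Y : Type*} [Fintype X] [Fintype U] [Fintype Y]
    (P : X × (U × Y × Y × Y) → ℝ) : Set (ℝ × ℝ × ℝ × ℝ × ℝ) :=
  let rvX : X × (U × Y × Y × Y) → X := fun ω => ω.1
  let rvU : X × (U × Y × Y × Y) → U := fun ω => ω.2.1
  let rvY₁ : X × (U × Y × Y × Y) → Y := fun ω => ω.2.2.1
  let rvY₂ : X × (U × Y × Y × Y) → Y := fun ω => ω.2.2.2.1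
  let rvY₁₂ : X × (U × Y × Y × Y) → Y := fun ω => ω.2.2.2.2
  {(R₁, R₂, _, _, _) : ℝ × ℝ × ℝ × ℝ × ℝ |
    mutualInfo P rvX (fun ω => (rvY₁ ω, rvU ω)) ≤ R₁ ∧
    mutualInfo P rvX (fun ω => (rvY₂ ω, rvU ω)) ≤ R₂ ∧
    mutualInfo P rvX rvU
      + mutualInfo P rvX (fun ω => (rvY₁ ω, rvY₂ ω, rvY₁₂ ω, rvU ω))
      + condMutualInfo P rvY₁ rvY₂ rvU ≤ R₁ + R₂}

/-- The union of the rate regions over all finite alphabets of the auxiliary variable `U` and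
all conditional PMFs `κ` of `(U, Ŷ⁽¹⁾, Ŷ⁽²⁾, Ŷ⁽¹²⁾)` given `X` such that, for `i = 1, 2, 12`,
the joint PMF of `(X, Ŷ⁽ⁱ⁾)` lies in the `Δᵢ`-neighborhood of `p₀(x) W(y|x)`. -/
def superpositionRegion {X : Type u} {Y : Type v} [Fintype X] [Fintype Y]
    (p₀ : X → ℝ) (W : X → Y → ℝ) : Set (ℝ × ℝ × ℝ × ℝ × ℝ) :=
  {(R₁, R₂, Δ₁, Δ₂, Δ₁₂) : ℝ × ℝ × ℝ × ℝ × ℝ |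
    ∃ (U : Type w) (_ : Fintype U) (κ : X → U × Y × Y × Y → ℝ),
      (∀ x, κ x ∈ stdSimplex ℝ (U × Y × Y × Y)) ∧
      jointPMF p₀ (fun x => law (κ x) (fun z => z.2.1)) ∈ nbhd Δ₁ (jointPMF p₀ W) ∧
      jointPMF p₀ (fun x => law (κ x) (fun z => z.2.2.1)) ∈ nbhd Δ₂ (jointPMF p₀ W) ∧
      jointPMF p₀ (fun x => law (κ x) (fun z => z.2.2.2)) ∈ nbhd Δ₁₂ (jointPMF p₀ W) ∧
      (R₁, R₂, Δ₁, Δ₂, Δ₁₂) ∈ rateRegion (jointPMF p₀ κ)}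

end

end MDCoord

/-! The proof is random superposition coding, with covering shown by a second-moment argument.

A codebook consists of M₀ independent clusters. A cluster has a cloud center drawn from the n-fold
law of U, then M₁ sequences for Ŷ⁽¹⁾ and M₂ sequences for Ŷ⁽²⁾, all conditionally independent given
the center, and for each pair of these one sequence for Ŷ⁽¹²⁾. Link k carries the cluster index and
the k-th satellite index, so a rate R_k fits when M₀ M_k ≤ e^{nR_k}. If the chosen codewords are
jointly typical with the source word, the joint types are near the single-letter laws, and all three
total variation bounds hold.

It remains to find a typical triple of indices for most source words. For fixed x, weight each
codeword tuple by its likelihood ratio κ/Q, restricted to typical tuples, where Q is the law that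
generates the tuple. The average weight of a cluster has as its mean the conditional probability
m(x) of typicality. Two index pairs in a cluster share the center alone, a row, a column, or both,
and typicality bounds the likelihood ratio that matters in each case by L₀, L₁, L₂, L₁₂. Hence the
second moment is at most (L₀ + L₁/M₁ + L₂/M₂ + 2L₁₂/(M₁M₂)) m(x), and averaging over clusters
divides the variance bound by M₀. Absence of a typical tuple makes the average vanish, which is a
large deviation from m(x). This is `exists_codebook`; `exists_block_codebook` applies it to n-letter
alphabets.

The exponents of the L's are I(X;U), I(X;Ŷ⁽ⁱ⁾,U) for i = 1, 2, and I(X;Ŷ⁽¹⁾,Ŷ⁽²⁾,Ŷ⁽¹²⁾,U) +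
I(Ŷ⁽¹⁾;Ŷ⁽²⁾|U). The last summand is the price of generating the two satellites independently given
U; the additional I(X;U) in the sum-rate bound is the price of sending the cluster index twice.
`exists_codebook_sizes` does this bookkeeping with slack δ, and the closure in the definition of the
region absorbs the slack. -/

namespace MDCoord

/-! ### Moments of sums of independent finite random variables. -/

/-- Summing a product function over all functions: the product of the sums. -/
lemma sum_pi_prod {I A : Type*} [Fintype I] [DecidableEq I] [Fintype A] (g : I → A → ℝ) :
    ∑ c : I → A, ∏ i, g i (c i) = ∏ i, ∑ a, g i a := by
  rw [Finset.prod_univ_sum, Fintype.piFinset_univ]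

lemma sum_pi_prod_eq_one {I A : Type*} [Fintype I] [DecidableEq I] [Fintype A] {p : I → A → ℝ}
    (hp : ∀ i, ∑ a, p i a = 1) : ∑ c : I → A, ∏ i, p i (c i) = 1 := by
  rw [sum_pi_prod]; simp [hp]

/-- The factor at coordinate `i` is absorbed into the product as a family of factors equal to 1
elsewhere; the sum then factorizes and every other coordinate contributes mass 1. -/
lemma sum_pi_prod_mul_apply {I A : Type*} [Fintype I] [DecidableEq I] [Fintype A] {p : I → A → ℝ}
    (hp : ∀ i, ∑ a, p i a = 1) (i : I) (g : A → ℝ) :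
    ∑ c : I → A, (∏ l, p l (c l)) * g (c i) = ∑ a, p i a * g a := by
  have h : ∀ c : I → A, (∏ l, p l (c l)) * g (c i)
      = ∏ l, (p l (c l) * if l = i then g (c l) else 1) := by
    intro c
    rw [Finset.prod_mul_distrib]
    simp
  simp_rw [h]
  rw [sum_pi_prod (fun l a => p l a * if l = i then g a else 1)]
  rw [Finset.prod_eq_single i]
  · simp
  · intro l _ hl
    simp [hl, hp]
  · simp

lemma sum_pi_prod_mul_apply_mul_apply {I A : Type*} [Fintype I] [DecidableEq I] [Fintype A] {p : I → A → ℝ}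
    (hp : ∀ i, ∑ a, p i a = 1) {i j : I} (hij : i ≠ j) (g h : A → ℝ) :
    ∑ c : I → A, (∏ l, p l (c l)) * (g (c i) * h (c j))
      = (∑ a, p i a * g a) * ∑ a, p j a * h a := by
  have e : ∀ c : I → A, (∏ l, p l (c l)) * (g (c i) * h (c j))
      = ∏ l, (p l (c l) * ((if l = i then g (c l) else 1) * if l = j then h (c l) else 1)) := by
    intro c
    rw [Finset.prod_mul_distrib, Finset.prod_mul_distrib]
    simp
  simp_rw [e]
  rw [sum_pi_prod (fun l a => p l a * ((if l = i then g a else 1) * if l = j then h a else 1))]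
  rw [← Finset.mul_prod_erase _ _ (Finset.mem_univ i),
    ← Finset.mul_prod_erase _ _ (Finset.mem_erase.2 ⟨hij.symm, Finset.mem_univ j⟩)]
  rw [Finset.prod_eq_one]
  · simp [hij, hij.symm]
  · intro l hl
    simp only [Finset.mem_erase] at hl
    simp [hl.1, hl.2.1, hp]

/-- The mean of a sum of independent variables. -/
lemma sum_pi_prod_mul_sum {I A : Type*} [Fintype I] [DecidableEq I] [Fintype A] {p : I → A → ℝ}
    (hp : ∀ i, ∑ a, p i a = 1) (g : I → A → ℝ) :
    ∑ c : I → A, (∏ l, p l (c l)) * ∑ i, g i (c i) = ∑ i, ∑ a, p i a * g i a := by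
  simp_rw [Finset.mul_sum]
  rw [Finset.sum_comm]
  exact Finset.sum_congr rfl fun i _ => sum_pi_prod_mul_apply hp i (g i)

/-- A bound on the second moment of a sum of independent variables. -/
lemma sum_pi_prod_mul_sum_sq_le {I A : Type*} [Fintype I] [DecidableEq I] [Fintype A] {p : I → A → ℝ}
    (hp : ∀ i, ∑ a, p i a = 1) (g : I → A → ℝ) :
    ∑ c : I → A, (∏ l, p l (c l)) * (∑ i, g i (c i)) ^ 2
      ≤ (∑ i, ∑ a, p i a * g i a) ^ 2 + ∑ i, ∑ a, p i a * g i a ^ 2 := by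
  -- On the diagonal the square of the mean is added for free, being nonnegative. The cross terms
  -- then complete to the square of the total mean, and second moments stand in for variances.
  have key : ∀ i j : I, ∑ c : I → A, (∏ l, p l (c l)) * (g i (c i) * g j (c j))
      ≤ (∑ a, p i a * g i a) * (∑ a, p j a * g j a)
        + if i = j then ∑ a, p i a * g i a ^ 2 else 0 := by
    intro i j
    by_cases h : i = j
    · subst h
      rw [sum_pi_prod_mul_apply hp i (fun a => g i a * g i a), if_pos rfl]
      have := mul_self_nonneg (∑ a, p i a * g i a)
      simp_rw [sq]
      linarith
    · rw [sum_pi_prod_mul_apply_mul_apply hp h, if_neg h, add_zero]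
  calc ∑ c : I → A, (∏ l, p l (c l)) * (∑ i, g i (c i)) ^ 2
      = ∑ i, ∑ j, ∑ c : I → A, (∏ l, p l (c l)) * (g i (c i) * g j (c j)) := by
        simp_rw [sq, Finset.sum_mul_sum, Finset.mul_sum]
        rw [Finset.sum_comm]
        exact Finset.sum_congr rfl fun i _ => Finset.sum_comm
    _ ≤ ∑ i, ∑ j, ((∑ a, p i a * g i a) * (∑ a, p j a * g j a)
        + if i = j then ∑ a, p i a * g i a ^ 2 else 0) :=
        Finset.sum_le_sum fun i _ => Finset.sum_le_sum fun j _ => key i j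
    _ = _ := by
        simp_rw [Finset.sum_add_distrib, ← Finset.sum_mul_sum]
        simp [← sq]

/-- A bound on the second moment of an average of independent identically distributed
variables. -/
lemma sum_pi_prod_mul_avg_sq_le {I A : Type*} [Fintype I] [DecidableEq I] [Nonempty I] [Fintype A]
    {p : A → ℝ} (hp : ∑ a, p a = 1) (g : A → ℝ) :
    ∑ c : I → A, (∏ l, p (c l)) * ((Fintype.card I : ℝ)⁻¹ * ∑ i, g (c i)) ^ 2
      ≤ (∑ a, p a * g a) ^ 2 + (Fintype.card I : ℝ)⁻¹ * ∑ a, p a * g a ^ 2 := by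
  have hI : (Fintype.card I : ℝ) ≠ 0 := by simp
  have h := sum_pi_prod_mul_sum_sq_le (I := I) (p := fun _ => p) (fun _ => hp) (fun _ => g)
  simp only [Finset.sum_const, Finset.card_univ, nsmul_eq_mul] at h
  have e : ∑ c : I → A, (∏ l, p (c l)) * ((Fintype.card I : ℝ)⁻¹ * ∑ i, g (c i)) ^ 2
      = ((Fintype.card I : ℝ)⁻¹) ^ 2 * ∑ c : I → A, (∏ l, p (c l)) * (∑ i, g (c i)) ^ 2 := by
    rw [Finset.mul_sum]
    exact Finset.sum_congr rfl fun c _ => by ring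
  rw [e]
  refine (mul_le_mul_of_nonneg_left h (by positivity)).trans (le_of_eq ?_)
  field_simp

lemma sum_mul_le_of_le {A : Type*} [Fintype A] {p g : A → ℝ} {L : ℝ}
    (hp0 : ∀ a, 0 ≤ p a) (hp : ∑ a, p a = 1) (h : ∀ a, g a ≤ L) : ∑ a, p a * g a ≤ L := by
  calc ∑ a, p a * g a ≤ ∑ a, p a * L :=
        Finset.sum_le_sum fun a _ => mul_le_mul_of_nonneg_left (h a) (hp0 a)
    _ = L := by rw [← Finset.sum_mul, hp, one_mul]

/-- One of the two factors `g` is traded for its upper bound. This turns each second-moment term of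
the covering argument into a multiple of the first moment. -/
lemma sum_mul_sq_le {A : Type*} [Fintype A] {p g : A → ℝ} {L : ℝ}
    (hp0 : ∀ a, 0 ≤ p a) (h0 : ∀ a, 0 ≤ g a) (h : ∀ a, p a ≠ 0 → g a ≤ L) :
    ∑ a, p a * g a ^ 2 ≤ L * ∑ a, p a * g a := by
  rw [Finset.mul_sum]
  refine Finset.sum_le_sum fun a _ => ?_
  by_cases hpa : p a = 0
  · simp [hpa]
  · nlinarith [mul_le_mul_of_nonneg_left (h a hpa) (mul_nonneg (hp0 a) (h0 a))]

/-- A function takes a value that is at most a bound of its mean. -/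
lemma exists_le_of_sum_mul_le {A : Type*} [Fintype A] {p G : A → ℝ} {L : ℝ}
    (hp0 : ∀ a, 0 ≤ p a) (hp : ∑ a, p a = 1) (h : ∑ a, p a * G a ≤ L) : ∃ a, G a ≤ L := by
  by_contra! hc
  have h1 : ∑ a, p a * G a ≥ ∑ a, p a * L :=
    Finset.sum_le_sum fun a _ => mul_le_mul_of_nonneg_left (hc a).le (hp0 a)
  rw [← Finset.sum_mul, hp, one_mul] at h1
  obtain ⟨a, ha⟩ : ∃ a, p a ≠ 0 := by
    by_contra! h0
    simp [h0] at hp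
  have h2 : ∑ a, p a * L < ∑ a, p a * G a :=
    Finset.sum_lt_sum (fun a _ => mul_le_mul_of_nonneg_left (hc a).le (hp0 a))
      ⟨a, Finset.mem_univ a, mul_lt_mul_of_pos_left (hc a) ((hp0 a).lt_of_ne' ha)⟩
  rw [← Finset.sum_mul, hp, one_mul] at h2
  linarith

/-! ### First and second moments over one random cluster. -/

section Cluster

variable {A B C D J K : Type*} [Fintype A] [Fintype B] [Fintype C] [Fintype D]
  [Fintype J] [DecidableEq J] [Fintype K] [DecidableEq K]

/-- The second moment of the sum of `w` over all pairs of codewords of a random cluster: rows `b j`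
and columns `c k` are independent, and `d (j, k)` is drawn given `b j` and `c k`. -/
lemma cluster_sum_sq_le {qB : B → ℝ} {qC : C → ℝ} {qD : B → C → D → ℝ}
    (hB0 : ∀ b, 0 ≤ qB b) (hB : ∑ b, qB b = 1) (hC0 : ∀ c, 0 ≤ qC c) (hC : ∑ c, qC c = 1)
    (hD : ∀ b c, ∑ d, qD b c d = 1) (w : B → C → D → ℝ) :
    ∑ b : J → B, (∏ j, qB (b j)) * ∑ c : K → C, (∏ k, qC (c k)) *
      ∑ d : J × K → D, (∏ l, qD (b l.1) (c l.2) (d l)) * (∑ l, w (b l.1) (c l.2) (d l)) ^ 2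
    ≤ ((Fintype.card J : ℝ) * Fintype.card K * ∑ b, qB b * ∑ c, qC c * ∑ d, qD b c d * w b c d) ^ 2
      + (Fintype.card K : ℝ) ^ 2 * (Fintype.card J *
          ∑ b, qB b * (∑ c, qC c * ∑ d, qD b c d * w b c d) ^ 2)
      + (Fintype.card J : ℝ) ^ 2 * (Fintype.card K *
          ∑ c, qC c * (∑ b, qB b * ∑ d, qD b c d * w b c d) ^ 2)
      + (Fintype.card J : ℝ) * (Fintype.card K *
          ∑ c, qC c * ∑ b, qB b * (∑ d, qD b c d * w b c d) ^ 2)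
      + (Fintype.card J : ℝ) * (Fintype.card K *
          ∑ c, qC c * ∑ b, qB b * ∑ d, qD b c d * w b c d ^ 2) := by
  set v : B → C → ℝ := fun b c => ∑ d, qD b c d * w b c d with hv
  set s : B → C → ℝ := fun b c => ∑ d, qD b c d * w b c d ^ 2 with hs
  have hBp : ∀ b : J → B, 0 ≤ ∏ j, qB (b j) := fun b => Finset.prod_nonneg fun _ _ => hB0 _
  have hCp : ∀ c : K → C, 0 ≤ ∏ k, qC (c k) := fun c => Finset.prod_nonneg fun _ _ => hC0 _
  -- The randomness is integrated out from the inside: pair codewords given rows and columns, then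
  -- columns given rows, then rows. Each stage replaces a second moment by a squared mean plus a
  -- diagonal term. The two terms of order |J||K| in the result come from the diagonals of the last
  -- two stages and from the diagonal of the first.
  have stepD : ∀ (b : J → B) (c : K → C),
      ∑ d : J × K → D, (∏ l, qD (b l.1) (c l.2) (d l)) * (∑ l, w (b l.1) (c l.2) (d l)) ^ 2
      ≤ (∑ k, ∑ j, v (b j) (c k)) ^ 2 + ∑ k, ∑ j, s (b j) (c k) := by
    intro b c
    refine (sum_pi_prod_mul_sum_sq_le (p := fun l : J × K => qD (b l.1) (c l.2))
      (fun l => hD _ _) (fun l d => w (b l.1) (c l.2) d)).trans (le_of_eq ?_)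
    rw [Fintype.sum_prod_type_right, Fintype.sum_prod_type_right]
  have stepC : ∀ b : J → B,
      ∑ c : K → C, (∏ k, qC (c k)) * ((∑ k, ∑ j, v (b j) (c k)) ^ 2 + ∑ k, ∑ j, s (b j) (c k))
      ≤ (Fintype.card K : ℝ) ^ 2 * (∑ j, ∑ c, qC c * v (b j) c) ^ 2
        + Fintype.card K * ∑ c, qC c * (∑ j, v (b j) c) ^ 2
        + Fintype.card K * ∑ c, qC c * ∑ j, s (b j) c := by
    intro b
    simp_rw [mul_add]
    rw [Finset.sum_add_distrib]
    have h1 := sum_pi_prod_mul_sum_sq_le (I := K) (p := fun _ => qC) (fun _ => hC)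
      (fun _ c => ∑ j, v (b j) c)
    have h2 := sum_pi_prod_mul_sum (I := K) (p := fun _ => qC) (fun _ => hC)
      (fun _ c => ∑ j, s (b j) c)
    simp only [Finset.sum_const, Finset.card_univ, nsmul_eq_mul] at h1 h2
    rw [h2]
    have e : ∑ c, qC c * ∑ j, v (b j) c = ∑ j, ∑ c, qC c * v (b j) c := by
      simp_rw [Finset.mul_sum]
      exact Finset.sum_comm
    rw [e, mul_pow] at h1
    linarith
  have stepB : ∀ g : B → ℝ, ∑ b : J → B, (∏ j, qB (b j)) * (∑ j, g (b j)) ^ 2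
      ≤ (Fintype.card J : ℝ) ^ 2 * (∑ b, qB b * g b) ^ 2
        + Fintype.card J * ∑ b, qB b * g b ^ 2 := by
    intro g
    have h1 := sum_pi_prod_mul_sum_sq_le (I := J) (p := fun _ => qB) (fun _ => hB) (fun _ => g)
    simp only [Finset.sum_const, Finset.card_univ, nsmul_eq_mul] at h1
    rwa [mul_pow] at h1
  have stepB' : ∀ g : B → ℝ, ∑ b : J → B, (∏ j, qB (b j)) * (∑ j, g (b j))
      = Fintype.card J * ∑ b, qB b * g b := by
    intro g
    have h1 := sum_pi_prod_mul_sum (I := J) (p := fun _ => qB) (fun _ => hB) (fun _ => g)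
    simpa only [Finset.sum_const, Finset.card_univ, nsmul_eq_mul] using h1
  have swap : ∀ F : (J → B) → C → ℝ, ∑ b : J → B, (∏ j, qB (b j)) * ∑ c, qC c * F b c
      = ∑ c, qC c * ∑ b : J → B, (∏ j, qB (b j)) * F b c := by
    intro F
    simp_rw [Finset.mul_sum]
    rw [Finset.sum_comm]
    exact Finset.sum_congr rfl fun c _ => Finset.sum_congr rfl fun b _ => by ring
  calc _ ≤ ∑ b : J → B, (∏ j, qB (b j)) * ((Fintype.card K : ℝ) ^ 2 *
          (∑ j, ∑ c, qC c * v (b j) c) ^ 2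
        + Fintype.card K * ∑ c, qC c * (∑ j, v (b j) c) ^ 2
        + Fintype.card K * ∑ c, qC c * ∑ j, s (b j) c) := by
        refine Finset.sum_le_sum fun b _ => mul_le_mul_of_nonneg_left ?_ (hBp b)
        exact (Finset.sum_le_sum fun c _ => mul_le_mul_of_nonneg_left (stepD b c) (hCp c)).trans
          (stepC b)
    _ = (Fintype.card K : ℝ) ^ 2 * ∑ b : J → B, (∏ j, qB (b j)) *
          (∑ j, ∑ c, qC c * v (b j) c) ^ 2
        + Fintype.card K * ∑ c, qC c * ∑ b : J → B, (∏ j, qB (b j)) * (∑ j, v (b j) c) ^ 2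
        + Fintype.card K * ∑ c, qC c * ∑ b : J → B, (∏ j, qB (b j)) * ∑ j, s (b j) c := by
        rw [← swap, ← swap]
        simp_rw [mul_add, Finset.sum_add_distrib, mul_left_comm _ (Fintype.card K : ℝ),
          mul_left_comm _ ((Fintype.card K : ℝ) ^ 2), ← Finset.mul_sum]
    _ ≤ (Fintype.card K : ℝ) ^ 2 * ((Fintype.card J : ℝ) ^ 2 *
          (∑ b, qB b * ∑ c, qC c * v b c) ^ 2
          + Fintype.card J * ∑ b, qB b * (∑ c, qC c * v b c) ^ 2)
        + Fintype.card K * ∑ c, qC c * ((Fintype.card J : ℝ) ^ 2 * (∑ b, qB b * v b c) ^ 2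
          + Fintype.card J * ∑ b, qB b * v b c ^ 2)
        + Fintype.card K * ∑ c, qC c * (Fintype.card J * ∑ b, qB b * s b c) := by
        refine add_le_add (add_le_add ?_ ?_) (le_of_eq ?_)
        · exact mul_le_mul_of_nonneg_left (stepB fun b => ∑ c, qC c * v b c) (by positivity)
        · refine mul_le_mul_of_nonneg_left (Finset.sum_le_sum fun c _ => ?_) (by positivity)
          exact mul_le_mul_of_nonneg_left (stepB fun b => v b c) (hC0 c)
        · exact congrArg _ (Finset.sum_congr rfl fun c _ => by rw [stepB' fun b => s b c])
    _ = _ := by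
        simp_rw [mul_add, Finset.sum_add_distrib, mul_left_comm (qC _), ← Finset.mul_sum]
        ring

/-- The mean of the sum of `w` over all pairs of codewords of a random cluster. -/
lemma cluster_sum_eq {qB : B → ℝ} {qC : C → ℝ} {qD : B → C → D → ℝ}
    (hB : ∑ b, qB b = 1) (hC : ∑ c, qC c = 1)
    (hD : ∀ b c, ∑ d, qD b c d = 1) (w : B → C → D → ℝ) :
    ∑ b : J → B, (∏ j, qB (b j)) * ∑ c : K → C, (∏ k, qC (c k)) *
      ∑ d : J × K → D, (∏ l, qD (b l.1) (c l.2) (d l)) * ∑ l, w (b l.1) (c l.2) (d l)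
    = (Fintype.card J : ℝ) * Fintype.card K *
        ∑ b, qB b * ∑ c, qC c * ∑ d, qD b c d * w b c d := by
  have hd : ∀ (b : J → B) (c : K → C),
      ∑ d : J × K → D, (∏ l, qD (b l.1) (c l.2) (d l)) * ∑ l, w (b l.1) (c l.2) (d l)
      = ∑ k, ∑ j, ∑ d, qD (b j) (c k) d * w (b j) (c k) d := by
    intro b c
    rw [sum_pi_prod_mul_sum (p := fun l : J × K => qD (b l.1) (c l.2))
      (fun l => hD _ _) (fun l d => w (b l.1) (c l.2) d), Fintype.sum_prod_type_right]
  simp_rw [hd]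
  have hc : ∀ b : J → B, ∑ c : K → C, (∏ k, qC (c k)) *
      ∑ k, ∑ j, ∑ d, qD (b j) (c k) d * w (b j) (c k) d
      = ∑ j, Fintype.card K * ∑ c, qC c * ∑ d, qD (b j) c d * w (b j) c d := by
    intro b
    rw [sum_pi_prod_mul_sum (I := K) (p := fun _ => qC) (fun _ => hC)
      (fun _ c => ∑ j, ∑ d, qD (b j) c d * w (b j) c d)]
    simp only [Finset.sum_const, Finset.card_univ, nsmul_eq_mul]
    rw [← Finset.mul_sum, Finset.sum_comm]
    exact congrArg _ (Finset.sum_congr rfl fun c _ => by rw [Finset.mul_sum])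
  simp_rw [hc]
  rw [sum_pi_prod_mul_sum (I := J) (p := fun _ => qB) (fun _ => hB)
      (fun _ b => Fintype.card K * ∑ c, qC c * ∑ d, qD b c d * w b c d)]
  simp only [Finset.sum_const, Finset.card_univ, nsmul_eq_mul]
  simp_rw [mul_left_comm (qB _)]
  rw [← Finset.mul_sum, mul_assoc]

end Cluster

/-! ### One-shot superposition covering by the second-moment method. -/

section Covering

variable {A B C D : Type*} {J K : Type*} [Fintype J] [Fintype K]

/-- The law of a random cluster: a cloud center `a`, satellite codewords `b j` and `c k`
independent given `a`, and codewords `d (j, k)` drawn given `a`, `b j` and `c k`. -/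
def clusterPMF (qA : A → ℝ) (qB : A → B → ℝ) (qC : A → C → ℝ) (qD : A → B → C → D → ℝ)
    (s : A × (J → B) × (K → C) × (J × K → D)) : ℝ :=
  qA s.1 * ((∏ j, qB s.1 (s.2.1 j)) * ((∏ k, qC s.1 (s.2.2.1 k)) *
    ∏ l, qD s.1 (s.2.1 l.1) (s.2.2.1 l.2) (s.2.2.2 l)))

/-- The average of `w` over the pairs of codewords of a cluster. -/
noncomputable def clusterAvg (w : A → B → C → D → ℝ)
    (s : A × (J → B) × (K → C) × (J × K → D)) : ℝ :=
  ((Fintype.card J : ℝ) * Fintype.card K)⁻¹ *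
    ∑ l : J × K, w s.1 (s.2.1 l.1) (s.2.2.1 l.2) (s.2.2.2 l)

lemma clusterPMF_nonneg {qA : A → ℝ} {qB : A → B → ℝ} {qC : A → C → ℝ}
    {qD : A → B → C → D → ℝ} (hA0 : ∀ a, 0 ≤ qA a) (hB0 : ∀ a b, 0 ≤ qB a b) (hC0 : ∀ a c, 0 ≤ qC a c)
    (hD0 : ∀ a b c d, 0 ≤ qD a b c d) (s : A × (J → B) × (K → C) × (J × K → D)) :
    0 ≤ clusterPMF qA qB qC qD s :=
  mul_nonneg (hA0 _) <| mul_nonneg (Finset.prod_nonneg fun _ _ => hB0 _ _) <|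
    mul_nonneg (Finset.prod_nonneg fun _ _ => hC0 _ _) (Finset.prod_nonneg fun _ _ => hD0 _ _ _ _)

variable [Fintype A] [Fintype B] [Fintype C] [Fintype D] [DecidableEq J] [DecidableEq K]
  {qA : A → ℝ} {qB : A → B → ℝ} {qC : A → C → ℝ} {qD : A → B → C → D → ℝ}

lemma sum_clusterPMF_mul (G : A × (J → B) × (K → C) × (J × K → D) → ℝ) :
    ∑ s, clusterPMF qA qB qC qD s * G s = ∑ a, qA a * ∑ b : J → B, (∏ j, qB a (b j)) *
      ∑ c : K → C, (∏ k, qC a (c k)) *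
      ∑ d : J × K → D, (∏ l, qD a (b l.1) (c l.2) (d l)) * G (a, b, c, d) := by
  simp_rw [Fintype.sum_prod_type, clusterPMF, Finset.mul_sum, mul_assoc]

lemma sum_clusterPMF (hA : ∑ a, qA a = 1) (hB : ∀ a, ∑ b, qB a b = 1) (hC : ∀ a, ∑ c, qC a c = 1)
    (hD : ∀ a b c, ∑ d, qD a b c d = 1) :
    ∑ s : A × (J → B) × (K → C) × (J × K → D), clusterPMF qA qB qC qD s = 1 := by
  have h := sum_clusterPMF_mul (J := J) (K := K) (qA := qA) (qB := qB) (qC := qC) (qD := qD)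
    (fun _ => 1)
  simp only [mul_one] at h
  rw [h]
  have h1 : ∀ (a : A) (b : J → B) (c : K → C),
      ∑ d : J × K → D, ∏ l, qD a (b l.1) (c l.2) (d l) = 1 :=
    fun a b c => sum_pi_prod_eq_one (p := fun l : J × K => qD a (b l.1) (c l.2)) fun l => hD _ _ _
  have h2 : ∀ a, ∑ c : K → C, ∏ k, qC a (c k) = 1 :=
    fun a => sum_pi_prod_eq_one (p := fun _ : K => qC a) fun _ => hC a
  have h3 : ∀ a, ∑ b : J → B, ∏ j, qB a (b j) = 1 :=
    fun a => sum_pi_prod_eq_one (p := fun _ : J => qB a) fun _ => hB a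
  simp [h1, h2, h3, hA]

variable [Nonempty J] [Nonempty K]

lemma sum_clusterPMF_mul_clusterAvg (hB : ∀ a, ∑ b, qB a b = 1) (hC : ∀ a, ∑ c, qC a c = 1)
    (hD : ∀ a b c, ∑ d, qD a b c d = 1) (w : A → B → C → D → ℝ) :
    ∑ s : A × (J → B) × (K → C) × (J × K → D), clusterPMF qA qB qC qD s * clusterAvg w s
      = ∑ a, qA a * ∑ b, qB a b * ∑ c, qC a c * ∑ d, qD a b c d * w a b c d := by
  rw [sum_clusterPMF_mul]
  refine Finset.sum_congr rfl fun a _ => congrArg _ ?_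
  have h := cluster_sum_eq (J := J) (K := K) (hB a) (hC a) (hD a) (w a)
  have hJ : (Fintype.card J : ℝ) ≠ 0 := by simp
  have hK : (Fintype.card K : ℝ) ≠ 0 := by simp
  simp only [clusterAvg]
  simp_rw [mul_left_comm _ (((Fintype.card J : ℝ) * Fintype.card K)⁻¹), ← Finset.mul_sum]
  simp_rw [mul_left_comm _ (((Fintype.card J : ℝ) * Fintype.card K)⁻¹), ← Finset.mul_sum]
  simp_rw [mul_left_comm _ (((Fintype.card J : ℝ) * Fintype.card K)⁻¹), ← Finset.mul_sum]
  rw [h]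
  field_simp

/-- In each of the five terms of `cluster_sum_sq_le` one factor of the square is bounded by the
partial mean given what two index pairs share: the center (`L₀`), a row (`L₁`), a column (`L₂`), or
both (`L₁₂`, twice). What is left is the mean, and normalizing by (|J||K|)² gives the denominators.
-/
lemma sum_clusterPMF_mul_clusterAvg_sq_le (hA0 : ∀ a, 0 ≤ qA a) (hB0 : ∀ a b, 0 ≤ qB a b)
    (hC0 : ∀ a c, 0 ≤ qC a c) (hD0 : ∀ a b c d, 0 ≤ qD a b c d)
    (hB : ∀ a, ∑ b, qB a b = 1) (hC : ∀ a, ∑ c, qC a c = 1)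
    (hD : ∀ a b c, ∑ d, qD a b c d = 1) {w : A → B → C → D → ℝ} (hw : ∀ a b c d, 0 ≤ w a b c d)
    {L₀ L₁ L₂ L₁₂ : ℝ} (h₁₂ : ∀ a b c d, w a b c d ≤ L₁₂)
    (h₀ : ∀ a, ∑ b, qB a b * ∑ c, qC a c * ∑ d, qD a b c d * w a b c d ≤ L₀)
    (h₁ : ∀ a b, ∑ c, qC a c * ∑ d, qD a b c d * w a b c d ≤ L₁)
    (h₂ : ∀ a c, ∑ b, qB a b * ∑ d, qD a b c d * w a b c d ≤ L₂) :
    ∑ s : A × (J → B) × (K → C) × (J × K → D), clusterPMF qA qB qC qD s * clusterAvg w s ^ 2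
      ≤ (L₀ + L₁ / Fintype.card J + L₂ / Fintype.card K
          + 2 * L₁₂ / (Fintype.card J * Fintype.card K))
        * ∑ a, qA a * ∑ b, qB a b * ∑ c, qC a c * ∑ d, qD a b c d * w a b c d := by
  have hJ : (0 : ℝ) < Fintype.card J := by exact_mod_cast Fintype.card_pos
  have hK : (0 : ℝ) < Fintype.card K := by exact_mod_cast Fintype.card_pos
  have n12 : ∀ a b c, 0 ≤ ∑ d, qD a b c d * w a b c d := fun a b c =>
    Finset.sum_nonneg fun d _ => mul_nonneg (hD0 _ _ _ _) (hw _ _ _ _)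
  have n1 : ∀ a b, 0 ≤ ∑ c, qC a c * ∑ d, qD a b c d * w a b c d := fun a b =>
    Finset.sum_nonneg fun c _ => mul_nonneg (hC0 _ _) (n12 _ _ _)
  have n2 : ∀ a c, 0 ≤ ∑ b, qB a b * ∑ d, qD a b c d * w a b c d := fun a c =>
    Finset.sum_nonneg fun b _ => mul_nonneg (hB0 _ _) (n12 _ _ _)
  have n0 : ∀ a, 0 ≤ ∑ b, qB a b * ∑ c, qC a c * ∑ d, qD a b c d * w a b c d := fun a =>
    Finset.sum_nonneg fun b _ => mul_nonneg (hB0 _ _) (n1 _ _)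
  have swap : ∀ (a : A) (f : B → C → ℝ),
      ∑ c, qC a c * ∑ b, qB a b * f b c = ∑ b, qB a b * ∑ c, qC a c * f b c := by
    intro a f
    simp_rw [Finset.mul_sum]
    rw [Finset.sum_comm]
    exact Finset.sum_congr rfl fun c _ => Finset.sum_congr rfl fun b _ => by ring
  have main : ∀ a, ∑ b : J → B, (∏ j, qB a (b j)) * ∑ c : K → C, (∏ k, qC a (c k)) *
      ∑ d : J × K → D, (∏ l, qD a (b l.1) (c l.2) (d l)) * clusterAvg w (a, b, c, d) ^ 2
      ≤ (L₀ + L₁ / Fintype.card J + L₂ / Fintype.card K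
          + 2 * L₁₂ / (Fintype.card J * Fintype.card K)) *
        ∑ b, qB a b * ∑ c, qC a c * ∑ d, qD a b c d * w a b c d := by
    intro a
    have h := cluster_sum_sq_le (J := J) (K := K) (hB0 a) (hB a) (hC0 a) (hC a) (hD a) (w a)
    set m := ∑ b, qB a b * ∑ c, qC a c * ∑ d, qD a b c d * w a b c d with hm
    have t0 : m ^ 2 ≤ L₀ * m := by
      nlinarith [mul_le_mul_of_nonneg_right (h₀ a) (n0 a)]
    have t1 : ∑ b, qB a b * (∑ c, qC a c * ∑ d, qD a b c d * w a b c d) ^ 2 ≤ L₁ * m :=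
      sum_mul_sq_le (hB0 a) (n1 a) fun b _ => h₁ a b
    have t2 : ∑ c, qC a c * (∑ b, qB a b * ∑ d, qD a b c d * w a b c d) ^ 2 ≤ L₂ * m := by
      rw [hm, ← swap]
      exact sum_mul_sq_le (hC0 a) (n2 a) fun c _ => h₂ a c
    have t3 : ∑ c, qC a c * ∑ b, qB a b * (∑ d, qD a b c d * w a b c d) ^ 2 ≤ L₁₂ * m := by
      rw [hm, ← swap, Finset.mul_sum]
      refine Finset.sum_le_sum fun c _ => ?_
      rw [mul_left_comm]
      refine mul_le_mul_of_nonneg_left ?_ (hC0 a c)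
      exact sum_mul_sq_le (hB0 a) (fun b => n12 a b c) fun b _ =>
        sum_mul_le_of_le (hD0 a b c) (hD a b c) (h₁₂ a b c)
    have t4 : ∑ c, qC a c * ∑ b, qB a b * ∑ d, qD a b c d * w a b c d ^ 2 ≤ L₁₂ * m := by
      rw [hm, ← swap, Finset.mul_sum]
      refine Finset.sum_le_sum fun c _ => ?_
      rw [mul_left_comm]
      refine mul_le_mul_of_nonneg_left ?_ (hC0 a c)
      rw [Finset.mul_sum]
      refine Finset.sum_le_sum fun b _ => ?_
      rw [mul_left_comm]
      refine mul_le_mul_of_nonneg_left ?_ (hB0 a b)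
      exact sum_mul_sq_le (hD0 a b c) (hw a b c) fun d _ => h₁₂ a b c d
    simp only [clusterAvg, mul_pow]
    simp_rw [mul_left_comm _ ((((Fintype.card J : ℝ) * Fintype.card K)⁻¹) ^ 2), ← Finset.mul_sum]
    simp_rw [mul_left_comm _ ((((Fintype.card J : ℝ) * Fintype.card K)⁻¹) ^ 2), ← Finset.mul_sum]
    simp_rw [mul_left_comm _ ((((Fintype.card J : ℝ) * Fintype.card K)⁻¹) ^ 2), ← Finset.mul_sum]
    refine (mul_le_mul_of_nonneg_left h (by positivity)).trans ?_
    rw [mul_pow]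
    calc _ ≤ (((Fintype.card J : ℝ) * Fintype.card K)⁻¹) ^ 2 *
          (((Fintype.card J : ℝ) * Fintype.card K) ^ 2 * (L₀ * m)
          + (Fintype.card K : ℝ) ^ 2 * (Fintype.card J * (L₁ * m))
          + (Fintype.card J : ℝ) ^ 2 * (Fintype.card K * (L₂ * m))
          + (Fintype.card J : ℝ) * (Fintype.card K * (L₁₂ * m))
          + (Fintype.card J : ℝ) * (Fintype.card K * (L₁₂ * m))) := by gcongr
      _ = _ := by field_simp; ring
  rw [sum_clusterPMF_mul, Finset.mul_sum]
  refine Finset.sum_le_sum fun a _ => ?_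
  rw [mul_left_comm]
  exact mul_le_mul_of_nonneg_left (main a) (hA0 a)

/-- One-shot superposition covering: some codebook of `|I|` clusters covers `X`, in the sense of
the relation `T`, up to the displayed probability. -/
theorem exists_codebook {X I : Type*} [Fintype X] [Fintype I] [DecidableEq I] [Nonempty I]
    (hA0 : ∀ a, 0 ≤ qA a) (hB0 : ∀ a b, 0 ≤ qB a b)
    (hC0 : ∀ a c, 0 ≤ qC a c) (hD0 : ∀ a b c d, 0 ≤ qD a b c d)
    (hA : ∑ a, qA a = 1) (hB : ∀ a, ∑ b, qB a b = 1) (hC : ∀ a, ∑ c, qC a c = 1)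
    (hD : ∀ a b c, ∑ d, qD a b c d = 1)
    {p : X → ℝ} (hp0 : ∀ x, 0 ≤ p x) (hp : ∑ x, p x = 1)
    {κ : X → A → B → C → D → ℝ} (hκ0 : ∀ x a b c d, 0 ≤ κ x a b c d)
    (hκ : ∀ x, ∑ a, ∑ b, ∑ c, ∑ d, κ x a b c d = 1)
    (T : X → A → B → C → D → Prop) [∀ x a b c d, Decidable (T x a b c d)]
    {L₀ L₁ L₂ L₁₂ : ℝ} (hL₀ : 0 ≤ L₀) (hL₁ : 0 ≤ L₁) (hL₂ : 0 ≤ L₂) (hL₁₂ : 0 ≤ L₁₂)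
    (h₁₂ : ∀ x a b c d, T x a b c d → κ x a b c d ≤ L₁₂ * (qA a * qB a b * qC a c * qD a b c d))
    (h₀ : ∀ x a b c d, T x a b c d → ∑ b, ∑ c, ∑ d, κ x a b c d ≤ L₀ * qA a)
    (h₁ : ∀ x a b c d, T x a b c d → ∑ c, ∑ d, κ x a b c d ≤ L₁ * (qA a * qB a b))
    (h₂ : ∀ x a b c d, T x a b c d → ∑ b, ∑ d, κ x a b c d ≤ L₂ * (qA a * qC a c)) :
    ∃ cb : I → A × (J → B) × (K → C) × (J × K → D),
      ∑ x, p x * (open Classical in if ∃ i j k, T x (cb i).1 ((cb i).2.1 j) ((cb i).2.2.1 k)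
        ((cb i).2.2.2 (j, k)) then 0 else 1)
      ≤ 2 * ((L₀ + L₁ / Fintype.card J + L₂ / Fintype.card K
          + 2 * L₁₂ / (Fintype.card J * Fintype.card K)) / Fintype.card I)
        + 2 * ∑ x, p x * ∑ a, ∑ b, ∑ c, ∑ d, if T x a b c d then 0 else κ x a b c d := by
  classical
  have hI : (0 : ℝ) < Fintype.card I := by exact_mod_cast Fintype.card_pos
  set Q : A → B → C → D → ℝ := fun a b c d => qA a * qB a b * qC a c * qD a b c d with hQ
  have hQ0 : ∀ a b c d, 0 ≤ Q a b c d := fun a b c d =>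
    mul_nonneg (mul_nonneg (mul_nonneg (hA0 _) (hB0 _ _)) (hC0 _ _)) (hD0 _ _ _ _)
  -- The likelihood ratio between the desired conditional law and the law generating the codebook,
  -- cut off outside `T`. Its mean under `Q` is the conditional probability of `T` given `x`, called
  -- `m x` below.
  set w : X → A → B → C → D → ℝ := fun x a b c d =>
    if T x a b c d then κ x a b c d / Q a b c d else 0 with hwdef
  have hw0 : ∀ x a b c d, 0 ≤ w x a b c d := by
    intro x a b c d
    simp only [hwdef]
    split_ifs
    · exact div_nonneg (hκ0 _ _ _ _ _) (hQ0 _ _ _ _)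
    · exact le_rfl
  have hQw : ∀ x a b c d, Q a b c d * w x a b c d = if T x a b c d then κ x a b c d else 0 := by
    intro x a b c d
    simp only [hwdef]
    split_ifs with h
    -- Where `Q` vanishes the quotient is 0 by convention; the change of measure survives because
    -- `h₁₂` forces `κ` to vanish there too.
    · by_cases hq : Q a b c d = 0
      · have := h₁₂ x a b c d h
        have := hκ0 x a b c d
        have hq' : qA a * qB a b * qC a c * qD a b c d = 0 := hq
        rw [hq]
        simp only [hq', mul_zero] at *
        linarith
      · field_simp
    · simp
  have hQwle : ∀ x a b c d, Q a b c d * w x a b c d ≤ κ x a b c d := by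
    intro x a b c d
    rw [hQw]
    split_ifs
    · exact le_rfl
    · exact hκ0 _ _ _ _ _
  set m : X → ℝ := fun x => ∑ a, ∑ b, ∑ c, ∑ d, if T x a b c d then κ x a b c d else 0 with hmdef
  have hm : ∀ x, ∑ a, qA a * ∑ b, qB a b * ∑ c, qC a c * ∑ d, qD a b c d * w x a b c d = m x := by
    intro x
    simp only [hmdef, ← hQw, hQ, Finset.mul_sum, mul_assoc]
  have hm1 : ∀ x, 1 - m x = ∑ a, ∑ b, ∑ c, ∑ d, if T x a b c d then 0 else κ x a b c d := by
    intro x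
    rw [← hκ x, sub_eq_iff_eq_add]
    simp only [hmdef, ← Finset.sum_add_distrib]
    refine Finset.sum_congr rfl fun a _ => Finset.sum_congr rfl fun b _ =>
      Finset.sum_congr rfl fun c _ => Finset.sum_congr rfl fun d _ => ?_
    split_ifs <;> simp
  have hm0 : ∀ x, 0 ≤ m x := fun x => Finset.sum_nonneg fun a _ => Finset.sum_nonneg fun b _ =>
    Finset.sum_nonneg fun c _ => Finset.sum_nonneg fun d _ => by
      split_ifs
      · exact hκ0 _ _ _ _ _
      · exact le_rfl
  have hm1' : ∀ x, 0 ≤ 1 - m x := fun x => by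
    rw [hm1]
    exact Finset.sum_nonneg fun a _ => Finset.sum_nonneg fun b _ =>
      Finset.sum_nonneg fun c _ => Finset.sum_nonneg fun d _ => by
        split_ifs
        · exact le_rfl
        · exact hκ0 _ _ _ _ _
  have b12 : ∀ x a b c d, w x a b c d ≤ L₁₂ := by
    intro x a b c d
    simp only [hwdef]
    split_ifs with h
    · exact div_le_of_le_mul₀ (hQ0 _ _ _ _) hL₁₂ (h₁₂ x a b c d h)
    · exact hL₁₂
  -- Multiplied by `qA a`, the partial mean is at most a marginal of `κ`, which `h₀` bounds. That
  -- hypothesis is available only when some tuple through `a` satisfies `T`; otherwise every weight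
  -- is zero. The next two bounds follow the same pattern.
  have b0 : ∀ x a, ∑ b, qB a b * ∑ c, qC a c * ∑ d, qD a b c d * w x a b c d ≤ L₀ := by
    intro x a
    by_cases hT : ∃ b c d, T x a b c d
    · obtain ⟨b', c', d', hT⟩ := hT
      by_cases hq : qA a = 0
      · simpa [hwdef, hQ, hq] using hL₀
      · have hpos := (hA0 a).lt_of_ne' hq
        rw [← mul_le_mul_iff_right₀ hpos]
        refine le_trans (le_of_eq_of_le ?_ (Finset.sum_le_sum fun b _ => Finset.sum_le_sum fun c _ =>
          Finset.sum_le_sum fun d _ => hQwle x a b c d)) ((h₀ x a b' c' d' hT).trans_eq (mul_comm _ _))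
        simp only [hQ, Finset.mul_sum, mul_assoc]
    · push Not at hT
      simpa [hwdef, hT] using hL₀
  have b1 : ∀ x a b, ∑ c, qC a c * ∑ d, qD a b c d * w x a b c d ≤ L₁ := by
    intro x a b
    by_cases hT : ∃ c d, T x a b c d
    · obtain ⟨c', d', hT⟩ := hT
      by_cases hq : qA a * qB a b = 0
      · simpa [hwdef, hQ, hq] using hL₁
      · have hpos := (mul_nonneg (hA0 a) (hB0 a b)).lt_of_ne' hq
        rw [← mul_le_mul_iff_right₀ hpos]
        refine le_trans (le_of_eq_of_le ?_ (Finset.sum_le_sum fun c _ =>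
          Finset.sum_le_sum fun d _ => hQwle x a b c d)) ((h₁ x a b c' d' hT).trans_eq (mul_comm _ _))
        simp only [hQ, Finset.mul_sum, mul_assoc]
    · push Not at hT
      simpa [hwdef, hT] using hL₁
  have b2 : ∀ x a c, ∑ b, qB a b * ∑ d, qD a b c d * w x a b c d ≤ L₂ := by
    intro x a c
    by_cases hT : ∃ b d, T x a b c d
    · obtain ⟨b', d', hT⟩ := hT
      by_cases hq : qA a * qC a c = 0
      · have hq' : ∀ b, qA a * qB a b * qC a c = 0 := fun b => by
          rw [mul_right_comm, hq, zero_mul]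
        simpa [hwdef, hQ, hq'] using hL₂
      · have hpos := (mul_nonneg (hA0 a) (hC0 a c)).lt_of_ne' hq
        rw [← mul_le_mul_iff_right₀ hpos]
        refine le_trans (le_of_eq_of_le ?_ (Finset.sum_le_sum fun b _ =>
          Finset.sum_le_sum fun d _ => hQwle x a b c d)) ((h₂ x a b' c d' hT).trans_eq (mul_comm _ _))
        simp only [hQ, Finset.mul_sum]
        exact Finset.sum_congr rfl fun b _ => Finset.sum_congr rfl fun d _ => by ring
    · push Not at hT
      simpa [hwdef, hT] using hL₂
  set L := L₀ + L₁ / Fintype.card J + L₂ / Fintype.card K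
          + 2 * L₁₂ / (Fintype.card J * Fintype.card K) with hL
  have hLnn : 0 ≤ L := by positivity
  have hq0 := clusterPMF_nonneg (J := J) (K := K) hA0 hB0 hC0 hD0
  have hq1 := sum_clusterPMF (J := J) (K := K) hA hB hC hD
  set q := clusterPMF (J := J) (K := K) qA qB qC qD with hqdef
  have hmean : ∀ x, ∑ s, q s * clusterAvg (w x) s = m x := fun x => by
    rw [← hm, ← sum_clusterPMF_mul_clusterAvg (J := J) (K := K) hB hC hD]
  have hsq : ∀ x, ∑ s, q s * clusterAvg (w x) s ^ 2 ≤ L := fun x => by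
    refine (sum_clusterPMF_mul_clusterAvg_sq_le hA0 hB0 hC0 hD0 hB hC hD (hw0 x) (b12 x) (b0 x)
      (b1 x) (b2 x)).trans ?_
    rw [hm]
    nlinarith [hm1' x]
  -- The cluster averages are independent over `i` and centered at `m x`, so the squared mean drops
  -- out; their variance is at most their second moment, hence at most `L`.
  have hvar : ∀ x, ∑ cb : I → A × (J → B) × (K → C) × (J × K → D), (∏ i, q (cb i)) *
      ((Fintype.card I : ℝ)⁻¹ * ∑ i, (clusterAvg (w x) (cb i) - m x)) ^ 2
      ≤ L / Fintype.card I := by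
    intro x
    refine (sum_pi_prod_mul_avg_sq_le (I := I) hq1 (fun s => clusterAvg (w x) s - m x)).trans ?_
    have e1 : ∑ s, q s * (clusterAvg (w x) s - m x) = 0 := by
      simp_rw [mul_sub, Finset.sum_sub_distrib, hmean, ← Finset.sum_mul, hq1]
      ring
    have e2 : ∑ s, q s * (clusterAvg (w x) s - m x) ^ 2
        = ∑ s, q s * clusterAvg (w x) s ^ 2 - m x ^ 2 := by
      have : ∀ s, q s * (clusterAvg (w x) s - m x) ^ 2 = q s * clusterAvg (w x) s ^ 2
          - 2 * m x * (q s * clusterAvg (w x) s) + m x ^ 2 * q s := fun s => by ring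
      simp_rw [this, Finset.sum_add_distrib, Finset.sum_sub_distrib, ← Finset.mul_sum, hmean, hq1]
      ring
    rw [e1, e2, div_eq_inv_mul]
    have := hsq x
    have : (Fintype.card I : ℝ)⁻¹ * (∑ s, q s * clusterAvg (w x) s ^ 2 - m x ^ 2)
        ≤ (Fintype.card I : ℝ)⁻¹ * L :=
      mul_le_mul_of_nonneg_left (by nlinarith [sq_nonneg (m x)]) (by positivity)
    linarith
  -- On failure all cluster averages are zero, so the squared deviation is m², and 2m² + 2(1 - m) ≥
  -- 1 because m² + (1 - m)² ≥ 0. Otherwise the right side only has to be nonnegative.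
  have hfail : ∀ (x : X) (cb : I → A × (J → B) × (K → C) × (J × K → D)),
      (if ∃ i j k, T x (cb i).1 ((cb i).2.1 j) ((cb i).2.2.1 k)
        ((cb i).2.2.2 (j, k)) then (0 : ℝ) else 1)
      ≤ 2 * ((Fintype.card I : ℝ)⁻¹ * ∑ i, (clusterAvg (w x) (cb i) - m x)) ^ 2
        + 2 * (1 - m x) := by
    intro x cb
    split_ifs with h
    · have := hm1' x
      positivity
    · push Not at h
      have hz : ∀ i, clusterAvg (w x) (cb i) = 0 := by
        intro i
        simp only [clusterAvg, hwdef]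
        rw [Finset.sum_eq_zero, mul_zero]
        rintro ⟨j, k⟩ _
        exact if_neg (h i j k)
      simp only [hz, zero_sub, Finset.sum_const, Finset.card_univ, nsmul_eq_mul]
      rw [inv_mul_cancel_left₀ hI.ne']
      have := hm1' x
      have := hm0 x
      nlinarith [sq_nonneg (2 * m x - 1)]
  refine exists_le_of_sum_mul_le (p := fun cb : I → A × (J → B) × (K → C) × (J × K → D) =>
    ∏ i, q (cb i)) (fun cb => Finset.prod_nonneg fun i _ => hq0 _)
    (sum_pi_prod_eq_one (p := fun _ : I => q) fun _ => hq1) ?_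
  have hone : ∑ cb : I → A × (J → B) × (K → C) × (J × K → D), ∏ i, q (cb i) = 1 :=
    sum_pi_prod_eq_one (p := fun _ : I => q) fun _ => hq1
  simp_rw [← hm1]
  calc _ ≤ ∑ cb : I → A × (J → B) × (K → C) × (J × K → D), (∏ i, q (cb i)) *
        ∑ x, p x * (2 * ((Fintype.card I : ℝ)⁻¹ * ∑ i, (clusterAvg (w x) (cb i) - m x)) ^ 2
        + 2 * (1 - m x)) :=
        Finset.sum_le_sum fun cb _ => mul_le_mul_of_nonneg_left
          (Finset.sum_le_sum fun x _ => mul_le_mul_of_nonneg_left (hfail x cb) (hp0 x))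
          (Finset.prod_nonneg fun i _ => hq0 _)
    _ = ∑ x, p x * (2 * ∑ cb : I → A × (J → B) × (K → C) × (J × K → D), (∏ i, q (cb i)) *
        ((Fintype.card I : ℝ)⁻¹ * ∑ i, (clusterAvg (w x) (cb i) - m x)) ^ 2
        + 2 * (1 - m x)) := by
        have e : ∀ x, 2 * (1 - m x) = ∑ cb : I → A × (J → B) × (K → C) × (J × K → D),
            (∏ i, q (cb i)) * (2 * (1 - m x)) := fun x => by rw [← Finset.sum_mul, hone, one_mul]
        simp_rw [Finset.mul_sum (a := (2 : ℝ))]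
        conv_rhs => enter [2, x]; rw [e x, ← Finset.sum_add_distrib, Finset.mul_sum]
        simp_rw [Finset.mul_sum (s := (Finset.univ : Finset X))]
        rw [Finset.sum_comm]
        exact Finset.sum_congr rfl fun x _ => Finset.sum_congr rfl fun cb _ => by ring
    _ ≤ ∑ x, p x * (2 * (L / Fintype.card I) + 2 * (1 - m x)) :=
        Finset.sum_le_sum fun x _ => mul_le_mul_of_nonneg_left
          (add_le_add (mul_le_mul_of_nonneg_left (hvar x) zero_le_two) le_rfl) (hp0 x)
    _ = _ := by
        simp_rw [mul_add, Finset.sum_add_distrib, ← Finset.sum_mul, hp, Finset.mul_sum]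
        rw [one_mul]
        exact congrArg _ (Finset.sum_congr rfl fun x _ => by ring)

end Covering

/-! ### Typical sequences and product measures. -/

/-- Letterwise positive sequences whose empirical means of the functions `F k` are within `δ` of
their means under `P`. -/
def IsTypical {Ω S : Type*} [Fintype Ω] (P : Ω → ℝ) (F : S → Ω → ℝ) (δ : ℝ) {n : ℕ}
    (ω : Fin n → Ω) : Prop :=
  (∀ i, 0 < P (ω i)) ∧ ∀ k, |∑ i, F k (ω i) - n * ∑ z, P z * F k z| ≤ n * δ

open Classical in
/-- Chebyshev's inequality for finitely many empirical means. -/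
lemma sum_not_isTypical_le {Ω S : Type*} [Fintype Ω] [Fintype S] {P : Ω → ℝ}
    (hP0 : ∀ z, 0 ≤ P z) (hP : ∑ z, P z = 1) (F : S → Ω → ℝ) {δ : ℝ} (hδ : 0 < δ) {n : ℕ}
    (hn : 0 < n) :
    ∑ ω : Fin n → Ω, (if IsTypical P F δ ω then 0 else ∏ i, P (ω i))
      ≤ (∑ k, ∑ z, P z * F k z ^ 2) / δ ^ 2 / n := by
  have hn' : (0 : ℝ) < n := by exact_mod_cast hn
  set μ : S → ℝ := fun k => ∑ z, P z * F k z with hμ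
  have hPp : ∀ ω : Fin n → Ω, 0 ≤ ∏ i, P (ω i) := fun ω => Finset.prod_nonneg fun _ _ => hP0 _
  have hk : ∀ k, ∑ ω : Fin n → Ω, (∏ i, P (ω i)) * (∑ i, (F k (ω i) - μ k)) ^ 2
      ≤ n * ∑ z, P z * F k z ^ 2 := by
    intro k
    refine (sum_pi_prod_mul_sum_sq_le (I := Fin n) (p := fun _ => P) (fun _ => hP)
      (fun _ z => F k z - μ k)).trans ?_
    have e1 : ∑ z, P z * (F k z - μ k) = 0 := by
      simp_rw [mul_sub, Finset.sum_sub_distrib, ← Finset.sum_mul, hP]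
      simp [hμ]
    have e2 : ∑ z, P z * (F k z - μ k) ^ 2 = ∑ z, P z * F k z ^ 2 - μ k ^ 2 := by
      have : ∀ z, P z * (F k z - μ k) ^ 2 = P z * F k z ^ 2
          - 2 * μ k * (P z * F k z) + μ k ^ 2 * P z := fun z => by ring
      simp_rw [this, Finset.sum_add_distrib, Finset.sum_sub_distrib, ← Finset.mul_sum, hP]
      simp only [hμ]
      ring
    simp only [e1, e2, Finset.sum_const_zero, Finset.sum_const, Finset.card_univ, Fintype.card_fin,
      nsmul_eq_mul]
    nlinarith [sq_nonneg (μ k), mul_nonneg hn'.le (sq_nonneg (μ k))]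
  have hpt : ∀ ω : Fin n → Ω, (if IsTypical P F δ ω then 0 else ∏ i, P (ω i))
      ≤ ∑ k, ((n * δ) ^ 2)⁻¹ * ((∏ i, P (ω i)) * (∑ i, (F k (ω i) - μ k)) ^ 2) := by
    intro ω
    have hnn : ∀ k, 0 ≤ ((n * δ) ^ 2)⁻¹ * ((∏ i, P (ω i)) * (∑ i, (F k (ω i) - μ k)) ^ 2) :=
      fun k => mul_nonneg (by positivity) (mul_nonneg (hPp ω) (sq_nonneg _))
    split_ifs with h
    · exact Finset.sum_nonneg fun k _ => hnn k
    -- Requiring positive letters costs no probability: a sequence with a null letter has product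
    -- mass zero. Chebyshev is needed only for the empirical means.
    · by_cases hz : ∀ i, 0 < P (ω i)
      · have h' : ¬ ∀ k, |∑ i, F k (ω i) - n * ∑ z, P z * F k z| ≤ n * δ := fun hh => h ⟨hz, hh⟩
        push Not at h'
        obtain ⟨k, hk⟩ := h'
        refine le_trans ?_ (Finset.single_le_sum (fun k _ => hnn k) (Finset.mem_univ k))
        have e : ∑ i, (F k (ω i) - μ k) = ∑ i, F k (ω i) - n * ∑ z, P z * F k z := by
          simp [hμ]
        rw [e, ← sq_abs (∑ i, F k (ω i) - n * ∑ z, P z * F k z), mul_left_comm]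
        refine le_mul_of_one_le_right (hPp ω) ?_
        rw [inv_mul_eq_div, one_le_div (by positivity)]
        exact pow_le_pow_left₀ (by positivity) hk.le 2
      · push Not at hz
        obtain ⟨i, hi⟩ := hz
        rw [Finset.prod_eq_zero (Finset.mem_univ i) (le_antisymm hi (hP0 _))]
        simp
  refine (Finset.sum_le_sum fun ω _ => hpt ω).trans ?_
  rw [Finset.sum_comm]
  simp_rw [← Finset.mul_sum]
  refine (mul_le_mul_of_nonneg_left (Finset.sum_le_sum fun k _ => hk k) (by positivity)).trans
    (le_of_eq ?_)
  rw [← Finset.mul_sum]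
  field_simp

lemma sum_arrow_prod {ι A B : Type*} [Fintype ι] [DecidableEq ι] [Fintype A] [Fintype B]
    (G : (ι → A × B) → ℝ) : ∑ ω, G ω = ∑ a : ι → A, ∑ b : ι → B, G fun i => (a i, b i) := by
  rw [← Fintype.sum_prod_type' fun (a : ι → A) (b : ι → B) => G fun i => (a i, b i)]
  exact Fintype.sum_equiv (Equiv.arrowProdEquivProdArrow ι (fun _ => A) (fun _ => B)) _ _
    fun ω => rfl

lemma sum_sum_pi_prod {ι A B : Type*} [Fintype ι] [DecidableEq ι] [Fintype A] [Fintype B]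
    (g : ι → A → B → ℝ) :
    ∑ a : ι → A, ∑ b : ι → B, ∏ i, g i (a i) (b i) = ∏ i, ∑ a, ∑ b, g i a b := by
  rw [← sum_arrow_prod fun ω => ∏ i, g i (ω i).1 (ω i).2,
    sum_pi_prod fun i (z : A × B) => g i z.1 z.2]
  simp_rw [Fintype.sum_prod_type]

lemma sum_sum_sum_pi_prod {ι A B C : Type*} [Fintype ι] [DecidableEq ι] [Fintype A] [Fintype B]
    [Fintype C] (g : ι → A → B → C → ℝ) :
    ∑ a : ι → A, ∑ b : ι → B, ∑ c : ι → C, ∏ i, g i (a i) (b i) (c i)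
      = ∏ i, ∑ a, ∑ b, ∑ c, g i a b c := by
  have h : ∀ a : ι → A, ∑ b : ι → B, ∑ c : ι → C, ∏ i, g i (a i) (b i) (c i)
      = ∏ i, ∑ b, ∑ c, g i (a i) b c := fun a => sum_sum_pi_prod fun i => g i (a i)
  simp_rw [h]
  exact sum_pi_prod fun i a => ∑ b, ∑ c, g i a b c

/-- Letterwise likelihood ratio bounds multiply on typical sequences. -/
lemma IsTypical.prod_le {Ω S : Type*} [Fintype Ω] {P : Ω → ℝ} {F : S → Ω → ℝ} {δ : ℝ} {n : ℕ}
    {ω : Fin n → Ω} (h : IsTypical P F δ ω) (k : S) {r q : Ω → ℝ} (hr : ∀ z, 0 ≤ r z)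
    (hq : ∀ z, 0 ≤ q z) (hrq : ∀ z, 0 < P z → r z ≤ Real.exp (F k z) * q z) :
    ∏ i, r (ω i) ≤ Real.exp (n * (∑ z, P z * F k z + δ)) * ∏ i, q (ω i) := by
  calc ∏ i, r (ω i) ≤ ∏ i, (Real.exp (F k (ω i)) * q (ω i)) :=
        Finset.prod_le_prod (fun i _ => hr _) fun i _ => hrq _ (h.1 i)
    _ = Real.exp (∑ i, F k (ω i)) * ∏ i, q (ω i) := by
        rw [Finset.prod_mul_distrib, Real.exp_sum]
    _ ≤ _ := by
        refine mul_le_mul_of_nonneg_right (Real.exp_le_exp.2 ?_)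
          (Finset.prod_nonneg fun _ _ => hq _)
        have := (abs_le.1 (h.2 k)).2
        linarith

/-! ### Covering of memoryless sources. -/

section Block

variable {X A B C D S : Type*} [Fintype X] [Fintype A] [Fintype B] [Fintype C] [Fintype D]
  [Fintype S] {qA : A → ℝ} {qB : A → B → ℝ} {qC : A → C → ℝ} {qD : A → B → C → D → ℝ}

open Classical in
/-- Superposition covering of memoryless sources by typical sequences. -/
theorem exists_block_codebook {I J K : Type*} [Fintype I] [DecidableEq I] [Nonempty I] [Fintype J]
    [DecidableEq J] [Nonempty J] [Fintype K] [DecidableEq K] [Nonempty K]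
    (hA0 : ∀ a, 0 ≤ qA a) (hB0 : ∀ a b, 0 ≤ qB a b)
    (hC0 : ∀ a c, 0 ≤ qC a c) (hD0 : ∀ a b c d, 0 ≤ qD a b c d)
    (hA : ∑ a, qA a = 1) (hB : ∀ a, ∑ b, qB a b = 1) (hC : ∀ a, ∑ c, qC a c = 1)
    (hD : ∀ a b c, ∑ d, qD a b c d = 1)
    {p : X → ℝ} (hp0 : ∀ x, 0 ≤ p x) (hp : ∑ x, p x = 1)
    {κ : X → A × B × C × D → ℝ} (hκ0 : ∀ x z, 0 ≤ κ x z) (hκ : ∀ x, ∑ z, κ x z = 1)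
    (F : S → X × (A × B × C × D) → ℝ) {k₀ k₁ k₂ k₁₂ : S}
    (h₁₂ : ∀ x a b c d, 0 < jointPMF p κ (x, a, b, c, d) →
      κ x (a, b, c, d) ≤ Real.exp (F k₁₂ (x, a, b, c, d)) *
        (qA a * qB a b * qC a c * qD a b c d))
    (h₀ : ∀ x a b c d, 0 < jointPMF p κ (x, a, b, c, d) →
      ∑ b, ∑ c, ∑ d, κ x (a, b, c, d) ≤ Real.exp (F k₀ (x, a, b, c, d)) * qA a)
    (h₁ : ∀ x a b c d, 0 < jointPMF p κ (x, a, b, c, d) →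
      ∑ c, ∑ d, κ x (a, b, c, d) ≤ Real.exp (F k₁ (x, a, b, c, d)) * (qA a * qB a b))
    (h₂ : ∀ x a b c d, 0 < jointPMF p κ (x, a, b, c, d) →
      ∑ b, ∑ d, κ x (a, b, c, d) ≤ Real.exp (F k₂ (x, a, b, c, d)) * (qA a * qC a c))
    {δ : ℝ} (hδ : 0 < δ) {n : ℕ} (hn : 0 < n) :
    ∃ cb : I → (Fin n → A) × (J → Fin n → B) × (K → Fin n → C) × (J × K → Fin n → D),
      ∑ x : Fin n → X, (∏ i, p (x i)) * (if ∃ i j k, IsTypical (jointPMF p κ) F δ (fun t =>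
        (x t, (cb i).1 t, (cb i).2.1 j t, (cb i).2.2.1 k t, (cb i).2.2.2 (j, k) t)) then 0 else 1)
      ≤ 2 * ((Real.exp (n * (∑ z, jointPMF p κ z * F k₀ z + δ))
          + Real.exp (n * (∑ z, jointPMF p κ z * F k₁ z + δ)) / Fintype.card J
          + Real.exp (n * (∑ z, jointPMF p κ z * F k₂ z + δ)) / Fintype.card K
          + 2 * Real.exp (n * (∑ z, jointPMF p κ z * F k₁₂ z + δ))
            / (Fintype.card J * Fintype.card K)) / Fintype.card I)
        + 2 * ((∑ k, ∑ z, jointPMF p κ z * F k z ^ 2) / δ ^ 2 / n) := by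
  have hP0 : ∀ z, 0 ≤ jointPMF p κ z := fun z => mul_nonneg (hp0 _) (hκ0 _ _)
  have hP : ∑ z, jointPMF p κ z = 1 := by
    rw [Fintype.sum_prod_type]
    simp only [jointPMF, ← Finset.mul_sum, hκ, mul_one, hp]
  set P := jointPMF p κ with hPdef
  -- The one-shot theorem is used with n-letter alphabets, product laws and typicality as the
  -- relation. Marginals of a product law are products of marginals, so each letterwise ratio bound
  -- becomes an exponential bound through `IsTypical.prod_le`.
  obtain ⟨cb, hcb⟩ := exists_codebook (I := I) (J := J) (K := K)
    (qA := fun a : Fin n → A => ∏ i, qA (a i))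
    (qB := fun (a : Fin n → A) (b : Fin n → B) => ∏ i, qB (a i) (b i))
    (qC := fun (a : Fin n → A) (c : Fin n → C) => ∏ i, qC (a i) (c i))
    (qD := fun (a : Fin n → A) (b : Fin n → B) (c : Fin n → C) (d : Fin n → D) =>
      ∏ i, qD (a i) (b i) (c i) (d i))
    (fun _ => Finset.prod_nonneg fun _ _ => hA0 _)
    (fun _ _ => Finset.prod_nonneg fun _ _ => hB0 _ _)
    (fun _ _ => Finset.prod_nonneg fun _ _ => hC0 _ _)
    (fun _ _ _ _ => Finset.prod_nonneg fun _ _ => hD0 _ _ _ _)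
    (sum_pi_prod_eq_one (p := fun _ : Fin n => qA) fun _ => hA)
    (fun a => sum_pi_prod_eq_one (p := fun i : Fin n => qB (a i)) fun _ => hB _)
    (fun a => sum_pi_prod_eq_one (p := fun i : Fin n => qC (a i)) fun _ => hC _)
    (fun a b c => sum_pi_prod_eq_one (p := fun i : Fin n => qD (a i) (b i) (c i)) fun _ => hD _ _ _)
    (p := fun x : Fin n → X => ∏ i, p (x i)) (fun _ => Finset.prod_nonneg fun _ _ => hp0 _)
    (sum_pi_prod_eq_one (p := fun _ : Fin n => p) fun _ => hp)
    (κ := fun (x : Fin n → X) (a : Fin n → A) (b : Fin n → B) (c : Fin n → C) (d : Fin n → D) =>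
      ∏ i, κ (x i) (a i, b i, c i, d i))
    (fun _ _ _ _ _ => Finset.prod_nonneg fun _ _ => hκ0 _ _)
    (fun x => by
      have h := sum_pi_prod_eq_one (p := fun i : Fin n => κ (x i)) fun _ => hκ _
      rw [sum_arrow_prod] at h
      simp_rw [sum_arrow_prod] at h
      exact h)
    (fun x a b c d => IsTypical P F δ fun t => (x t, a t, b t, c t, d t))
    (L₀ := Real.exp (n * (∑ z, P z * F k₀ z + δ)))
    (L₁ := Real.exp (n * (∑ z, P z * F k₁ z + δ)))
    (L₂ := Real.exp (n * (∑ z, P z * F k₂ z + δ)))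
    (L₁₂ := Real.exp (n * (∑ z, P z * F k₁₂ z + δ)))
    (Real.exp_nonneg _) (Real.exp_nonneg _) (Real.exp_nonneg _) (Real.exp_nonneg _)
    (fun x a b c d hT => by
      simp_rw [← Finset.prod_mul_distrib]
      exact hT.prod_le k₁₂ (r := fun z => κ z.1 z.2)
        (q := fun z => qA z.2.1 * qB z.2.1 z.2.2.1 * qC z.2.1 z.2.2.2.1 *
          qD z.2.1 z.2.2.1 z.2.2.2.1 z.2.2.2.2)
        (fun _ => hκ0 _ _)
        (fun _ => mul_nonneg (mul_nonneg (mul_nonneg (hA0 _) (hB0 _ _)) (hC0 _ _)) (hD0 _ _ _ _))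
        (fun z hz => h₁₂ _ _ _ _ _ hz))
    (fun x a b c d hT => by
      rw [sum_sum_sum_pi_prod fun i b c d => κ (x i) (a i, b, c, d)]
      exact hT.prod_le k₀ (r := fun z => ∑ b, ∑ c, ∑ d, κ z.1 (z.2.1, b, c, d))
        (q := fun z => qA z.2.1)
        (fun _ => Finset.sum_nonneg fun _ _ => Finset.sum_nonneg fun _ _ =>
          Finset.sum_nonneg fun _ _ => hκ0 _ _)
        (fun _ => hA0 _)
        (fun z hz => h₀ _ _ _ _ _ hz))
    (fun x a b c d hT => by
      rw [sum_sum_pi_prod fun i c d => κ (x i) (a i, b i, c, d), ← Finset.prod_mul_distrib]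
      exact hT.prod_le k₁ (r := fun z => ∑ c, ∑ d, κ z.1 (z.2.1, z.2.2.1, c, d))
        (q := fun z => qA z.2.1 * qB z.2.1 z.2.2.1)
        (fun _ => Finset.sum_nonneg fun _ _ => Finset.sum_nonneg fun _ _ => hκ0 _ _)
        (fun _ => mul_nonneg (hA0 _) (hB0 _ _))
        (fun z hz => h₁ _ _ _ _ _ hz))
    (fun x a b c d hT => by
      rw [sum_sum_pi_prod fun i b d => κ (x i) (a i, b, c i, d), ← Finset.prod_mul_distrib]
      exact hT.prod_le k₂ (r := fun z => ∑ b, ∑ d, κ z.1 (z.2.1, b, z.2.2.2.1, d))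
        (q := fun z => qA z.2.1 * qC z.2.1 z.2.2.2.1)
        (fun _ => Finset.sum_nonneg fun _ _ => Finset.sum_nonneg fun _ _ => hκ0 _ _)
        (fun _ => mul_nonneg (hA0 _) (hC0 _ _))
        (fun z hz => h₂ _ _ _ _ _ hz))
  refine ⟨cb, hcb.trans (add_le_add le_rfl (mul_le_mul_of_nonneg_left ?_ zero_le_two))⟩
  refine le_of_eq_of_le ?_ (sum_not_isTypical_le hP0 hP F hδ hn)
  simp_rw [sum_arrow_prod, Finset.mul_sum]
  refine Finset.sum_congr rfl fun x _ => Finset.sum_congr rfl fun a _ =>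
    Finset.sum_congr rfl fun b _ => Finset.sum_congr rfl fun c _ =>
    Finset.sum_congr rfl fun d _ => ?_
  simp only [mul_ite, mul_zero, ← Finset.prod_mul_distrib, hPdef, jointPMF]

end Block

/-! ### Marginal laws, mutual information and conditional laws. -/

section Law

variable {Ω A B C : Type*} [Fintype Ω] {P : Ω → ℝ}

lemma law_nonneg (hP : ∀ ω, 0 ≤ P ω) (f : Ω → A) (a : A) : 0 ≤ law P f a :=
  Finset.sum_nonneg fun ω _ => hP ω

lemma law_pos (hP : ∀ ω, 0 ≤ P ω) (f : Ω → A) {ω : Ω} (hω : 0 < P ω) : 0 < law P f (f ω) := by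
  classical
  exact Finset.sum_pos' (fun ω _ => hP ω) ⟨ω, by simp, hω⟩

lemma sum_law_mul [Fintype A] (P : Ω → ℝ) (f : Ω → A) (G : A → ℝ) :
    ∑ a, law P f a * G a = ∑ ω, P ω * G (f ω) := by
  classical
  simp only [law, Finset.sum_filter, Finset.sum_mul]
  rw [Finset.sum_comm]
  refine Finset.sum_congr rfl fun ω _ => ?_
  simp

lemma sum_law [Fintype A] (P : Ω → ℝ) (f : Ω → A) : ∑ a, law P f a = ∑ ω, P ω := by
  simpa using sum_law_mul P f fun _ => 1

lemma sum_law_prod_left [Fintype A] (P : Ω → ℝ) (f : Ω → A) (h : Ω → C) (c : C) :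
    ∑ a, law P (fun ω => (f ω, h ω)) (a, c) = law P h c := by
  classical
  simp only [law, Finset.sum_filter, Prod.mk.injEq, ite_and]
  rw [Finset.sum_comm]
  exact Finset.sum_congr rfl fun ω _ => by simp

lemma law_eq_of_iff {f : Ω → A} {g : Ω → B} {a : A} {b : B} (h : ∀ ω, f ω = a ↔ g ω = b) :
    law P f a = law P g b := by
  classical
  simp only [law, h]

/-- As the mean of an information density on Ω, mutual information is one of the means that
typicality controls. -/
lemma mutualInfo_eq_sum [Fintype A] [Fintype B] (P : Ω → ℝ) (f : Ω → A) (g : Ω → B) :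
    mutualInfo P f g = ∑ ω, P ω * Real.log (law P (fun ω => (f ω, g ω)) (f ω, g ω) /
      (law P f (f ω) * law P g (g ω))) := by
  rw [mutualInfo, ← Fintype.sum_prod_type' (fun a b => law P (fun ω => (f ω, g ω)) (a, b) *
    Real.log (law P (fun ω => (f ω, g ω)) (a, b) / (law P f a * law P g b)))]
  exact sum_law_mul P (fun ω => (f ω, g ω)) fun z =>
    Real.log (law P (fun ω => (f ω, g ω)) z / (law P f z.1 * law P g z.2))

lemma condMutualInfo_eq_sum [Fintype A] [Fintype B] [Fintype C] (P : Ω → ℝ) (f : Ω → A)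
    (g : Ω → B) (h : Ω → C) :
    condMutualInfo P f g h = ∑ ω, P ω * Real.log
      (law P (fun ω => (f ω, g ω, h ω)) (f ω, g ω, h ω) * law P h (h ω) /
      (law P (fun ω => (f ω, h ω)) (f ω, h ω) * law P (fun ω => (g ω, h ω)) (g ω, h ω))) := by
  rw [← sum_law_mul P (fun ω => (f ω, g ω, h ω)) fun z => Real.log
      (law P (fun ω => (f ω, g ω, h ω)) z * law P h z.2.2 /
      (law P (fun ω => (f ω, h ω)) (z.1, z.2.2) * law P (fun ω => (g ω, h ω)) z.2))]
  simp_rw [Fintype.sum_prod_type, condMutualInfo]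

/-- From log t ≥ 1 - 1/t: the mean of the inverse density is at most the total mass of the product
of the marginals, which is 1. -/
lemma mutualInfo_nonneg [Fintype A] [Fintype B] (hP : ∀ ω, 0 ≤ P ω) (hP1 : ∑ ω, P ω = 1)
    (f : Ω → A) (g : Ω → B) : 0 ≤ mutualInfo P f g := by
  have hpt : ∀ ω, P ω - P ω * (law P f (f ω) * law P g (g ω) /
      law P (fun ω => (f ω, g ω)) (f ω, g ω)) ≤ P ω *
      Real.log (law P (fun ω => (f ω, g ω)) (f ω, g ω) / (law P f (f ω) * law P g (g ω))) := by
    intro ω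
    rcases (hP ω).eq_or_lt with h | h
    · simp [← h]
    · have h1 := law_pos hP f h
      have h2 := law_pos hP g h
      have h3 := law_pos hP (fun ω => (f ω, g ω)) h
      have := Real.one_sub_inv_le_log_of_pos (div_pos h3 (mul_pos h1 h2))
      rw [inv_div] at this
      nlinarith [mul_le_mul_of_nonneg_left this (hP ω)]
  have hsum : ∑ ω, P ω * (law P f (f ω) * law P g (g ω) /
      law P (fun ω => (f ω, g ω)) (f ω, g ω)) ≤ 1 := by
    rw [← sum_law_mul P (fun ω => (f ω, g ω)) fun z => law P f z.1 * law P g z.2 /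
      law P (fun ω => (f ω, g ω)) z]
    calc _ ≤ ∑ z : A × B, law P f z.1 * law P g z.2 := by
          refine Finset.sum_le_sum fun z _ => ?_
          have h1 := law_nonneg hP (fun ω => (f ω, g ω)) z
          have h2 := mul_nonneg (law_nonneg hP f z.1) (law_nonneg hP g z.2)
          rcases h1.eq_or_lt with h | h
          · simpa [← h] using h2
          · rw [mul_div_cancel₀ _ h.ne']
      _ = 1 := by
          rw [Fintype.sum_prod_type]
          simp only [← Finset.mul_sum, sum_law, hP1, mul_one]
  rw [mutualInfo_eq_sum]
  have := Finset.sum_le_sum fun ω (_ : ω ∈ Finset.univ) => hpt ω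
  rw [Finset.sum_sub_distrib, hP1] at this
  linarith

/-- Mutual information does not decrease when a variable is adjoined. -/
lemma mutualInfo_le_mutualInfo_prod [Fintype A] [Fintype B] [Fintype C] (hP : ∀ ω, 0 ≤ P ω)
    (hP1 : ∑ ω, P ω = 1) (f : Ω → A) (g : Ω → B) (h : Ω → C) :
    mutualInfo P f h ≤ mutualInfo P f (fun ω => (g ω, h ω)) := by
  -- The law under which `f` and `g` are conditionally independent given `h`. The difference of the
  -- two densities is the log of its ratio to the true law, and log t ≤ t - 1 together with total
  -- mass 1 gives the claim.
  set r : A → B → C → ℝ := fun a b c =>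
    (law P (fun ω => (f ω, h ω)) (a, c) * law P (fun ω => (g ω, h ω)) (b, c)) / law P h c with hr
  have hpt : ∀ ω, P ω * Real.log (law P (fun ω => (f ω, h ω)) (f ω, h ω) /
        (law P f (f ω) * law P h (h ω)))
      - P ω * Real.log (law P (fun ω => (f ω, g ω, h ω)) (f ω, g ω, h ω) /
        (law P f (f ω) * law P (fun ω => (g ω, h ω)) (g ω, h ω)))
      ≤ P ω * (r (f ω) (g ω) (h ω) / law P (fun ω => (f ω, g ω, h ω)) (f ω, g ω, h ω)) - P ω := by
    intro ω
    rcases (hP ω).eq_or_lt with h0 | h0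
    · simp [← h0]
    · have h1 := law_pos hP f h0
      have h2 := law_pos hP h h0
      have h3 := law_pos hP (fun ω => (f ω, h ω)) h0
      have h4 := law_pos hP (fun ω => (g ω, h ω)) h0
      have h5 := law_pos hP (fun ω => (f ω, g ω, h ω)) h0
      rw [← mul_sub, ← Real.log_div (by positivity) (by positivity)]
      have e : law P (fun ω => (f ω, h ω)) (f ω, h ω) / (law P f (f ω) * law P h (h ω)) /
          (law P (fun ω => (f ω, g ω, h ω)) (f ω, g ω, h ω) /
            (law P f (f ω) * law P (fun ω => (g ω, h ω)) (g ω, h ω)))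
          = r (f ω) (g ω) (h ω) / law P (fun ω => (f ω, g ω, h ω)) (f ω, g ω, h ω) := by
        simp only [hr]
        field_simp
      rw [e]
      have hpos : 0 < r (f ω) (g ω) (h ω) / law P (fun ω => (f ω, g ω, h ω)) (f ω, g ω, h ω) := by
        simp only [hr]
        positivity
      nlinarith [mul_le_mul_of_nonneg_left (Real.log_le_sub_one_of_pos hpos) (hP ω)]
  have hr0 : ∀ a b c, 0 ≤ r a b c := fun a b c =>
    div_nonneg (mul_nonneg (law_nonneg hP _ _) (law_nonneg hP _ _)) (law_nonneg hP _ _)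
  have hsum : ∑ ω, P ω * (r (f ω) (g ω) (h ω) /
      law P (fun ω => (f ω, g ω, h ω)) (f ω, g ω, h ω)) ≤ 1 := by
    rw [← sum_law_mul P (fun ω => (f ω, g ω, h ω)) fun z => r z.1 z.2.1 z.2.2 /
      law P (fun ω => (f ω, g ω, h ω)) z]
    calc _ ≤ ∑ z : A × B × C, r z.1 z.2.1 z.2.2 := by
          refine Finset.sum_le_sum fun z _ => ?_
          rcases (law_nonneg hP (fun ω => (f ω, g ω, h ω)) z).eq_or_lt with h | h
          · simpa [← h] using hr0 _ _ _
          · rw [mul_div_cancel₀ _ h.ne']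
      _ = ∑ c, law P h c * law P h c / law P h c := by
          simp_rw [Fintype.sum_prod_type]
          rw [Finset.sum_congr rfl fun a _ => Finset.sum_comm, Finset.sum_comm]
          refine Finset.sum_congr rfl fun c _ => ?_
          simp only [hr]
          simp_rw [← Finset.sum_div, ← Finset.sum_mul_sum, sum_law_prod_left]
      _ = 1 := by
          -- Values `c` of probability zero cause no harm, as 0 · 0 / 0 = 0.
          simp_rw [mul_self_div_self]
          rw [sum_law, hP1]
  rw [mutualInfo_eq_sum, mutualInfo_eq_sum]
  have := Finset.sum_le_sum fun ω (_ : ω ∈ Finset.univ) => hpt ω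
  rw [Finset.sum_sub_distrib, Finset.sum_sub_distrib, hP1] at this
  linarith

open Classical in
/-- The conditional PMF of `f` given `h`; where `h` has probability zero it is the law of `f`. -/
noncomputable def condLaw (P : Ω → ℝ) (f : Ω → A) (h : Ω → C) (c : C) (a : A) : ℝ :=
  if law P h c = 0 then law P f a else law P (fun ω => (f ω, h ω)) (a, c) / law P h c

lemma condLaw_nonneg (hP : ∀ ω, 0 ≤ P ω) (f : Ω → A) (h : Ω → C) (c : C) (a : A) :
    0 ≤ condLaw P f h c a := by
  rw [condLaw]
  split_ifs
  · exact law_nonneg hP _ _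
  · exact div_nonneg (law_nonneg hP _ _) (law_nonneg hP _ _)

lemma sum_condLaw [Fintype A] (hP1 : ∑ ω, P ω = 1) (f : Ω → A) (h : Ω → C) (c : C) :
    ∑ a, condLaw P f h c a = 1 := by
  by_cases hc : law P h c = 0
  · simp [condLaw, hc, sum_law, hP1]
  · simp only [condLaw, hc, if_false]
    rw [← Finset.sum_div, sum_law_prod_left, div_self hc]

lemma condLaw_of_pos {f : Ω → A} {h : Ω → C} {c : C} (hc : 0 < law P h c) (a : A) :
    condLaw P f h c a = law P (fun ω => (f ω, h ω)) (a, c) / law P h c := by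
  simp [condLaw, hc.ne']

end Law

/-! ### Marginals of the joint law of source and auxiliary variables. -/

section JointLaw

variable {X A B C D : Type*} [Fintype X] [Fintype A] [Fintype B] [Fintype C] [Fintype D]
  (p : X → ℝ) (κ : X → A × B × C × D → ℝ)

lemma law_jointPMF_fst (hκ : ∀ x, ∑ z, κ x z = 1) (x : X) :
    law (jointPMF p κ) (fun ω => ω.1) x = p x := by
  classical
  simp only [law, Finset.sum_filter, Fintype.sum_prod_type (f := fun ω : X × _ => ite _ _ _),
    jointPMF]
  rw [Finset.sum_eq_single x (fun x' _ h => by simp [h]) (by simp)]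
  simp [← Finset.mul_sum, hκ]

lemma law_jointPMF_A (x : X) (a : A) :
    law (jointPMF p κ) (fun ω => (ω.1, ω.2.1)) (x, a)
      = p x * ∑ b, ∑ c, ∑ d, κ x (a, b, c, d) := by
  classical
  simp only [law, Finset.sum_filter, Fintype.sum_prod_type, jointPMF, Prod.mk.injEq]
  rw [Finset.sum_eq_single x (fun x' _ h => by simp [h]) (by simp),
    Finset.sum_eq_single a (fun x' _ h => by simp [h]) (by simp)]
  simp [Finset.mul_sum]

lemma law_jointPMF_BA (x : X) (a : A) (b : B) :
    law (jointPMF p κ) (fun ω => (ω.1, ω.2.2.1, ω.2.1)) (x, b, a)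
      = p x * ∑ c, ∑ d, κ x (a, b, c, d) := by
  classical
  simp only [law, Finset.sum_filter, Fintype.sum_prod_type, jointPMF, Prod.mk.injEq]
  rw [Finset.sum_eq_single x (fun x' _ h => by simp [h]) (by simp),
    Finset.sum_eq_single a (fun x' _ h => by simp [h]) (by simp),
    Finset.sum_eq_single b (fun x' _ h => by simp [h]) (by simp)]
  simp [Finset.mul_sum]

lemma law_jointPMF_CA (x : X) (a : A) (c : C) :
    law (jointPMF p κ) (fun ω => (ω.1, ω.2.2.2.1, ω.2.1)) (x, c, a)
      = p x * ∑ b, ∑ d, κ x (a, b, c, d) := by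
  classical
  simp only [law, Finset.sum_filter, Fintype.sum_prod_type, jointPMF, Prod.mk.injEq]
  rw [Finset.sum_eq_single x (fun x' _ h => by simp [h]) (by simp),
    Finset.sum_eq_single a (fun x' _ h => by simp [h]) (by simp), Finset.mul_sum]
  refine Finset.sum_congr rfl fun b _ => ?_
  rw [Finset.sum_eq_single c (fun x' _ h => by simp [h]) (by simp)]
  simp [Finset.mul_sum]

lemma law_jointPMF_BCDA (x : X) (a : A) (b : B) (c : C) (d : D) :
    law (jointPMF p κ) (fun ω => (ω.1, ω.2.2.1, ω.2.2.2.1, ω.2.2.2.2, ω.2.1)) (x, b, c, d, a)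
      = p x * κ x (a, b, c, d) := by
  classical
  simp only [law, Finset.sum_filter]
  rw [Finset.sum_eq_single (x, a, b, c, d)]
  · simp [jointPMF]
  · rintro ⟨x', a', b', c', d'⟩ _ h
    refine if_neg fun h' => h ?_
    simp only [Prod.mk.injEq] at h' ⊢
    tauto
  · simp

/-- The joint law of `X` and a function of the second coordinate. -/
lemma law_jointPMF_map {Z E : Type*} [Fintype Z] (p : X → ℝ) (κ : X → Z → ℝ) (g : Z → E)
    (x : X) (e : E) : law (jointPMF p κ) (fun ω => (ω.1, g ω.2)) (x, e)
      = jointPMF p (fun x => law (κ x) g) (x, e) := by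
  classical
  simp only [law, Finset.sum_filter, Fintype.sum_prod_type (f := fun ω : X × _ => ite _ _ _),
    jointPMF, Prod.mk.injEq]
  rw [Finset.sum_eq_single x (fun x' _ h => by simp [h]) (by simp)]
  simp [Finset.mul_sum]

end JointLaw

/-! ### Choice of the codebook sizes. -/

/-- The witness is the integer quotient of the number of messages by `M₀`. Rounding e^{n(R+3δ)} down
costs at most a factor 2, and so does the division, whence the 4. The quotient is positive since the
third δ supplies a factor e^{nδ} ≥ 4, against the 2 in the bound on `M₀` and the 2 lost in rounding.
-/
lemma exists_satellite_number {n : ℕ} {I R δ : ℝ} (hIR : I ≤ R) (hI : 0 ≤ I) (hδ : 0 < δ)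
    (hn : 4 ≤ Real.exp (n * δ)) {M₀ : ℕ} (hM₀ : 0 < M₀)
    (hM₀le : (M₀ : ℝ) ≤ 2 * Real.exp (n * (I + 2 * δ))) :
    ∃ M : ℕ, 0 < M ∧ M₀ * M ≤ numMessages n (R + 3 * δ) ∧
      Real.exp (n * (R + 3 * δ)) / 4 ≤ M₀ * M := by
  set N := numMessages n (R + 3 * δ) with hN
  have hn0 : (0 : ℝ) ≤ n := Nat.cast_nonneg n
  have hE : 2 ≤ Real.exp (n * (R + 3 * δ)) := by
    have : Real.exp (n * δ) ≤ Real.exp (n * (R + 3 * δ)) :=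
      Real.exp_le_exp.2 (mul_le_mul_of_nonneg_left (by linarith) hn0)
    linarith
  have hNge : Real.exp (n * (R + 3 * δ)) / 2 ≤ N := by
    have := Nat.sub_one_lt_floor (Real.exp (n * (R + 3 * δ)))
    rw [hN, numMessages]
    linarith
  have hM₀N : M₀ ≤ N := by
    have h1 : Real.exp (n * (R + 3 * δ)) = Real.exp (n * (R + 2 * δ)) * Real.exp (n * δ) := by
      rw [← Real.exp_add]; ring_nf
    have h2 : Real.exp (n * (I + 2 * δ)) ≤ Real.exp (n * (R + 2 * δ)) :=
      Real.exp_le_exp.2 (mul_le_mul_of_nonneg_left (by linarith) hn0)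
    have h3 : Real.exp (n * (R + 2 * δ)) * 4 ≤ Real.exp (n * (R + 2 * δ)) * Real.exp (n * δ) :=
      mul_le_mul_of_nonneg_left hn (Real.exp_nonneg _)
    have : (M₀ : ℝ) ≤ N := by linarith
    exact_mod_cast this
  have hM : 0 < N / M₀ := Nat.div_pos hM₀N hM₀
  refine ⟨N / M₀, hM, Nat.mul_div_le N M₀, ?_⟩
  have h1 : N < M₀ * (N / M₀ + 1) := by
    rw [mul_comm]; exact Nat.lt_mul_of_div_lt (Nat.lt_succ_self _) hM₀
  have h2 : M₀ * (N / M₀ + 1) ≤ 2 * (M₀ * (N / M₀)) := by nlinarith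
  have h3 : (N : ℝ) ≤ 2 * (M₀ * ((N / M₀ : ℕ) : ℝ)) := by exact_mod_cast h1.le.trans h2
  linarith

/-- The numbers of clusters and of satellite codewords that fit the rates. -/
lemma exists_codebook_sizes {n : ℕ} {I₀ I₁ I₂ S R₁ R₂ δ : ℝ} (h₀ : 0 ≤ I₀) (h₀₁ : I₀ ≤ I₁)
    (h₀₂ : I₀ ≤ I₂) (h₁ : I₁ ≤ R₁) (h₂ : I₂ ≤ R₂) (hS : I₀ + S ≤ R₁ + R₂) (hδ : 0 < δ)
    (hn : 4 ≤ Real.exp (n * δ)) :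
    ∃ M₀ M₁ M₂ : ℕ, 0 < M₀ ∧ 0 < M₁ ∧ 0 < M₂ ∧ M₀ * M₁ ≤ numMessages n (R₁ + 3 * δ) ∧
      M₀ * M₂ ≤ numMessages n (R₂ + 3 * δ) ∧
      (Real.exp (n * (I₀ + δ)) + Real.exp (n * (I₁ + δ)) / M₁ + Real.exp (n * (I₂ + δ)) / M₂
        + 2 * Real.exp (n * (S + δ)) / (M₁ * M₂)) / M₀ ≤ 73 * Real.exp (-(n * δ)) := by
  have hn0 : (0 : ℝ) ≤ n := Nat.cast_nonneg n
  -- The exponent exceeds that of the typicality bound I₀ + δ by one more δ, which makes the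
  -- cloud-center term decay.
  set M₀ := ⌈Real.exp (n * (I₀ + 2 * δ))⌉₊ with hM₀def
  have hM₀ge : Real.exp (n * (I₀ + 2 * δ)) ≤ M₀ := Nat.le_ceil _
  have hM₀R : (0 : ℝ) < M₀ := (Real.exp_pos _).trans_le hM₀ge
  have hM₀ : 0 < M₀ := by exact_mod_cast hM₀R
  have hM₀le : (M₀ : ℝ) ≤ 2 * Real.exp (n * (I₀ + 2 * δ)) := by
    have h1 : (M₀ : ℝ) < Real.exp (n * (I₀ + 2 * δ)) + 1 := Nat.ceil_lt_add_one (Real.exp_nonneg _)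
    have h2 : 1 ≤ Real.exp (n * (I₀ + 2 * δ)) := Real.one_le_exp (by positivity)
    linarith
  obtain ⟨M₁, hM₁, hM₁N, hM₁ge⟩ :=
    exists_satellite_number (h₀₁.trans h₁) h₀ hδ hn hM₀ hM₀le
  obtain ⟨M₂, hM₂, hM₂N, hM₂ge⟩ :=
    exists_satellite_number (h₀₂.trans h₂) h₀ hδ hn hM₀ hM₀le
  refine ⟨M₀, M₁, M₂, hM₀, hM₁, hM₂, hM₁N, hM₂N, ?_⟩
  have hM₁R : (0 : ℝ) < M₁ := by exact_mod_cast hM₁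
  have hM₂R : (0 : ℝ) < M₂ := by exact_mod_cast hM₂
  have t0 : Real.exp (n * (I₀ + δ)) / M₀ ≤ Real.exp (-(n * δ)) := by
    rw [div_le_iff₀ hM₀R]
    refine le_trans (le_of_eq ?_) (mul_le_mul_of_nonneg_left hM₀ge (Real.exp_nonneg _))
    rw [← Real.exp_add]; ring_nf
  have t1 : ∀ {I R : ℝ} {M : ℕ}, I ≤ R → (0 : ℝ) < M → Real.exp (n * (R + 3 * δ)) / 4 ≤ M₀ * M →
      Real.exp (n * (I + δ)) / M / M₀ ≤ 4 * Real.exp (-(n * δ)) := by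
    intro I R M hIR hM hge
    rw [div_div, div_le_iff₀ (by positivity), mul_comm (M : ℝ)]
    refine le_trans ?_ (mul_le_mul_of_nonneg_left hge (by positivity))
    have : Real.exp (n * (I + δ)) ≤ Real.exp (-(n * δ)) * Real.exp (n * (R + 3 * δ)) := by
      rw [← Real.exp_add]
      exact Real.exp_le_exp.2 (by nlinarith [mul_le_mul_of_nonneg_left hIR hn0, mul_nonneg hn0 hδ.le])
    linarith
  -- The product M₀M₁M₂ is (M₀M₁)(M₀M₂)/M₀, so the cluster count is paid for twice; this is where
  -- `hS` needs the extra I₀. The constant is 2 · 2 · 16: the coefficient, the rounding of `M₀`, and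
  -- the two quarters. With 1 + 4 + 4 from the other terms it makes 73.
  have t3 : 2 * Real.exp (n * (S + δ)) / (M₁ * M₂) / M₀ ≤ 64 * Real.exp (-(n * δ)) := by
    rw [div_div, div_le_iff₀ (by positivity)]
    have e1 : Real.exp (n * (R₁ + 3 * δ)) / 4 * (Real.exp (n * (R₂ + 3 * δ)) / 4)
        ≤ (M₀ * M₁) * (M₀ * M₂) := mul_le_mul hM₁ge hM₂ge (by positivity) (by positivity)
    have e2 : (M₀ * M₁ : ℝ) * (M₀ * M₂) ≤ 2 * Real.exp (n * (I₀ + 2 * δ)) * (M₁ * M₂ * M₀) := by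
      have := mul_le_mul_of_nonneg_right hM₀le (show (0 : ℝ) ≤ M₁ * M₂ * M₀ by positivity)
      linarith
    have e3 : Real.exp (n * (S + δ)) * Real.exp (n * (I₀ + 2 * δ))
        ≤ Real.exp (-(n * δ)) * (Real.exp (n * (R₁ + 3 * δ)) * Real.exp (n * (R₂ + 3 * δ))) := by
      rw [← Real.exp_add, ← Real.exp_add, ← Real.exp_add]
      exact Real.exp_le_exp.2 (by nlinarith [mul_le_mul_of_nonneg_left hS hn0, mul_nonneg hn0 hδ.le])
    have hpos := Real.exp_pos (n * (I₀ + 2 * δ))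
    rw [← mul_le_mul_iff_left₀ hpos]
    have e4 := mul_le_mul_of_nonneg_left (e1.trans e2) (Real.exp_nonneg (-(n * δ)))
    linarith
  rw [add_div, add_div, add_div]
  linarith [t1 h₁ hM₁R hM₁ge, t1 h₂ hM₂R hM₂ge]

/-! ### Total variation and joint types. -/

lemma tv_nonneg {A : Type*} [Fintype A] (p q : A → ℝ) : 0 ≤ tv p q :=
  mul_nonneg (by norm_num) (Finset.sum_nonneg fun _ _ => abs_nonneg _)

lemma tv_le_one {A : Type*} [Fintype A] {p q : A → ℝ} (hp : p ∈ stdSimplex ℝ A)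
    (hq : q ∈ stdSimplex ℝ A) : tv p q ≤ 1 := by
  have h : ∑ a, |p a - q a| ≤ ∑ a, (p a + q a) := Finset.sum_le_sum fun a _ =>
    abs_le.2 ⟨by linarith [hp.1 a, hq.1 a], by linarith [hp.1 a, hq.1 a]⟩
  rw [Finset.sum_add_distrib, hp.2, hq.2] at h
  rw [tv]
  linarith

lemma jointPMF_mem_stdSimplex {A B : Type*} [Fintype A] [Fintype B] {p : A → ℝ} {κ : A → B → ℝ}
    (hp : p ∈ stdSimplex ℝ A) (hκ : ∀ a, κ a ∈ stdSimplex ℝ B) :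
    jointPMF p κ ∈ stdSimplex ℝ (A × B) := by
  refine ⟨fun z => mul_nonneg (hp.1 _) ((hκ _).1 _), ?_⟩
  rw [Fintype.sum_prod_type]
  simp only [jointPMF, ← Finset.mul_sum, (hκ _).2, mul_one, hp.2]

section JointType

variable {X Y : Type*} [Fintype X] [Fintype Y] {n : ℕ}

lemma jointType_mem_stdSimplex (hn : 0 < n) (x : Fin n → X) (y : Fin n → Y) :
    jointType x y ∈ stdSimplex ℝ (X × Y) := by
  classical
  have hn' : (n : ℝ) ≠ 0 := by exact_mod_cast hn.ne'
  refine ⟨fun z => mul_nonneg (by positivity) (Finset.sum_nonneg fun i _ => ?_), ?_⟩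
  · split_ifs <;> norm_num
  · simp only [jointType]
    rw [← Finset.mul_sum, Finset.sum_comm]
    simp [hn']

-- Triangle inequality through `r` in each cell of the alphabet; the factor 1/2 on the deviations of
-- the type is given away.
open Classical in
lemma tv_jointType_le (hn : 0 < n) {x : Fin n → X} {y : Fin n → Y} (q : X × Y → ℝ)
    {r : X × Y → ℝ} {δ : ℝ} (hδ : 0 ≤ δ)
    (h : ∀ z, |∑ i, (if (x i, y i) = z then (1 : ℝ) else 0) - n * r z| ≤ n * δ) :
    tv (jointType x y) q ≤ tv q r + Fintype.card (X × Y) * δ := by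
  have hn' : (0 : ℝ) < n := by exact_mod_cast hn
  have h1 : ∀ z, |jointType x y z - q z| ≤ |q z - r z| + δ := by
    intro z
    have e : jointType x y z - r z
        = (1 / n) * (∑ i, (if (x i, y i) = z then (1 : ℝ) else 0) - n * r z) := by
      rw [jointType]; field_simp
    have h2 : |jointType x y z - r z| ≤ δ := by
      rw [e, abs_mul, abs_of_pos (by positivity : (0 : ℝ) < 1 / n), one_div, inv_mul_le_iff₀ hn']
      exact h z
    have := abs_sub_le (jointType x y z) (r z) (q z)
    rw [abs_sub_comm (r z)] at this
    linarith
  have h2 := Finset.sum_le_sum fun z (_ : z ∈ Finset.univ) => h1 z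
  rw [Finset.sum_add_distrib, Finset.sum_const, Finset.card_univ, nsmul_eq_mul] at h2
  have : 0 ≤ (Fintype.card (X × Y) : ℝ) * δ := by positivity
  rw [tv, tv]
  linarith

/-- The expected total variation is at most the total variation on good source sequences plus the
probability of the bad ones. -/
lemma expectedTV_le (hn : 0 < n) {p₀ : X → ℝ} (hp₀ : p₀ ∈ stdSimplex ℝ X) {q : X × Y → ℝ}
    (hq : q ∈ stdSimplex ℝ (X × Y)) {φ : (Fin n → X) → (Fin n → Y)} {G : (Fin n → X) → Prop}
    [DecidablePred G] {b ε : ℝ} (hb : 0 ≤ b) (hG : ∀ x, G x → tv (jointType x (φ x)) q ≤ b)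
    (hε : ∑ x : Fin n → X, (∏ i, p₀ (x i)) * (if G x then 0 else 1) ≤ ε) :
    expectedTV p₀ q φ ≤ b + ε := by
  have hp : ∀ x : Fin n → X, 0 ≤ ∏ i, p₀ (x i) := fun x => Finset.prod_nonneg fun _ _ => hp₀.1 _
  calc expectedTV p₀ q φ
      ≤ ∑ x : Fin n → X, (∏ i, p₀ (x i)) * (b + if G x then 0 else 1) := by
        refine Finset.sum_le_sum fun x _ => mul_le_mul_of_nonneg_left ?_ (hp x)
        split_ifs with h
        · simpa using hG x h
        · exact (tv_le_one (jointType_mem_stdSimplex hn x _) hq).trans (by linarith)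
    _ = b + ∑ x : Fin n → X, (∏ i, p₀ (x i)) * (if G x then 0 else 1) := by
        simp_rw [mul_add, Finset.sum_add_distrib, ← Finset.sum_mul]
        rw [sum_pi_prod_eq_one (p := fun _ : Fin n => p₀) fun _ => hp₀.2, one_mul]
    _ ≤ b + ε := by linarith

end JointType

/-! ### From codebooks to codes. -/

/-- A superposition codebook that fits the rates gives a coordination code. -/
lemma exists_coordinationCode {X Y : Type*} {R₁ R₂ : ℝ} {n M₀ M₁ M₂ : ℕ} (hM₀ : 0 < M₀) (hM₁ : 0 < M₁)
    (hM₂ : 0 < M₂) (h₁ : M₀ * M₁ ≤ numMessages n R₁) (h₂ : M₀ * M₂ ≤ numMessages n R₂)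
    (y₁ : Fin M₀ → Fin M₁ → Fin n → Y) (y₂ : Fin M₀ → Fin M₂ → Fin n → Y)
    (y₁₂ : Fin M₀ → Fin M₁ × Fin M₂ → Fin n → Y)
    (s : (Fin n → X) → Fin M₀ × Fin M₁ × Fin M₂) :
    ∃ c : CoordinationCode X Y R₁ R₂ n, ∀ x,
      c.dec₁ (c.enc₁ x) = y₁ (s x).1 (s x).2.1 ∧ c.dec₂ (c.enc₂ x) = y₂ (s x).1 (s x).2.2 ∧
      c.dec₁₂ (c.enc₁ x, c.enc₂ x) = y₁₂ (s x).1 (s x).2 := by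
  have : Nonempty (Fin M₀) := ⟨⟨0, hM₀⟩⟩
  have : Nonempty (Fin M₁) := ⟨⟨0, hM₁⟩⟩
  have : Nonempty (Fin M₂) := ⟨⟨0, hM₂⟩⟩
  obtain ⟨e₁⟩ : Nonempty (Fin M₀ × Fin M₁ ↪ Fin (numMessages n R₁)) :=
    Function.Embedding.nonempty_of_card_le (by simpa using h₁)
  obtain ⟨e₂⟩ : Nonempty (Fin M₀ × Fin M₂ ↪ Fin (numMessages n R₂)) :=
    Function.Embedding.nonempty_of_card_le (by simpa using h₂)
  have l₁ := Function.leftInverse_invFun e₁.injective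
  have l₂ := Function.leftInverse_invFun e₂.injective
  refine ⟨{ enc₁ := fun x => e₁ ((s x).1, (s x).2.1)
            enc₂ := fun x => e₂ ((s x).1, (s x).2.2)
            dec₁ := fun m => y₁ (Function.invFun e₁ m).1 (Function.invFun e₁ m).2
            dec₂ := fun m => y₂ (Function.invFun e₂ m).1 (Function.invFun e₂ m).2
            -- Both messages carry the cluster index; the joint decoder reads it from the first.
            dec₁₂ := fun m => y₁₂ (Function.invFun e₁ m.1).1
              ((Function.invFun e₁ m.1).2, (Function.invFun e₂ m.2).2) }, fun x => ?_⟩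
  simp only [l₁ _, l₂ _, Prod.mk.eta, and_self]

/-! ### The superposition scheme and its error analysis. -/

section Superposition

variable {X U Y : Type*} [Fintype X] [Fintype U] [Fintype Y]

open Classical in
/-- The test functions of the typical set: the four information densities of the scheme and the
indicators of the pairs `(x, y)` for each of the three reconstructions. -/
noncomputable def testFun (P : X × (U × Y × Y × Y) → ℝ) :
    Fin 4 ⊕ (Fin 3 × X × Y) → X × (U × Y × Y × Y) → ℝ
  | .inl k => ![
      fun ω => Real.log (law P (fun ω => (ω.1, ω.2.1)) (ω.1, ω.2.1) /
        (law P (fun ω => ω.1) ω.1 * law P (fun ω => ω.2.1) ω.2.1)),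
      fun ω => Real.log (law P (fun ω => (ω.1, ω.2.2.1, ω.2.1)) (ω.1, ω.2.2.1, ω.2.1) /
        (law P (fun ω => ω.1) ω.1 * law P (fun ω => (ω.2.2.1, ω.2.1)) (ω.2.2.1, ω.2.1))),
      fun ω => Real.log (law P (fun ω => (ω.1, ω.2.2.2.1, ω.2.1)) (ω.1, ω.2.2.2.1, ω.2.1) /
        (law P (fun ω => ω.1) ω.1 * law P (fun ω => (ω.2.2.2.1, ω.2.1)) (ω.2.2.2.1, ω.2.1))),
      fun ω => Real.log (law P (fun ω => (ω.1, ω.2.2.1, ω.2.2.2.1, ω.2.2.2.2, ω.2.1))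
          (ω.1, ω.2.2.1, ω.2.2.2.1, ω.2.2.2.2, ω.2.1) /
          (law P (fun ω => ω.1) ω.1 * law P (fun ω => (ω.2.2.1, ω.2.2.2.1, ω.2.2.2.2, ω.2.1))
            (ω.2.2.1, ω.2.2.2.1, ω.2.2.2.2, ω.2.1)))
        + Real.log (law P (fun ω => (ω.2.2.1, ω.2.2.2.1, ω.2.1)) (ω.2.2.1, ω.2.2.2.1, ω.2.1) *
          law P (fun ω => ω.2.1) ω.2.1 /
          (law P (fun ω => (ω.2.2.1, ω.2.1)) (ω.2.2.1, ω.2.1) *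
            law P (fun ω => (ω.2.2.2.1, ω.2.1)) (ω.2.2.2.1, ω.2.1)))] k
  | .inr (i, z) => fun ω =>
      if (ω.1, ![ω.2.2.1, ω.2.2.2.1, ω.2.2.2.2] i) = z then 1 else 0

lemma sum_mul_testFun_inr (P : X × (U × Y × Y × Y) → ℝ) (i : Fin 3) (z : X × Y) :
    ∑ ω, P ω * testFun P (.inr (i, z)) ω
      = law P (fun ω => (ω.1, ![ω.2.2.1, ω.2.2.2.1, ω.2.2.2.2] i)) z := by
  classical
  simp only [testFun, law, Finset.sum_filter]
  exact Finset.sum_congr rfl fun ω _ => by split_ifs <;> simp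

open Classical in
/-- Superposition codebooks whose typical part covers the source. -/
lemma exists_superposition_codebook {p : X → ℝ} (hp : p ∈ stdSimplex ℝ X)
    {κ : X → U × Y × Y × Y → ℝ} (hκ : ∀ x, κ x ∈ stdSimplex ℝ (U × Y × Y × Y))
    {M₀ M₁ M₂ : ℕ} (hM₀ : 0 < M₀) (hM₁ : 0 < M₁) (hM₂ : 0 < M₂)
    {δ : ℝ} (hδ : 0 < δ) {n : ℕ} (hn : 0 < n) :
    ∃ cb : Fin M₀ → (Fin n → U) × (Fin M₁ → Fin n → Y) × (Fin M₂ → Fin n → Y) ×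
        (Fin M₁ × Fin M₂ → Fin n → Y),
      ∑ x : Fin n → X, (∏ i, p (x i)) * (if ∃ i j k,
        IsTypical (jointPMF p κ) (testFun (jointPMF p κ)) δ (fun t =>
        (x t, (cb i).1 t, (cb i).2.1 j t, (cb i).2.2.1 k t, (cb i).2.2.2 (j, k) t)) then 0 else 1)
      ≤ 2 * ((Real.exp (n * (mutualInfo (jointPMF p κ) (fun ω => ω.1) (fun ω => ω.2.1) + δ))
          + Real.exp (n * (mutualInfo (jointPMF p κ) (fun ω => ω.1)
              (fun ω => (ω.2.2.1, ω.2.1)) + δ)) / M₁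
          + Real.exp (n * (mutualInfo (jointPMF p κ) (fun ω => ω.1)
              (fun ω => (ω.2.2.2.1, ω.2.1)) + δ)) / M₂
          + 2 * Real.exp (n * (mutualInfo (jointPMF p κ) (fun ω => ω.1)
              (fun ω => (ω.2.2.1, ω.2.2.2.1, ω.2.2.2.2, ω.2.1))
              + condMutualInfo (jointPMF p κ) (fun ω => ω.2.2.1) (fun ω => ω.2.2.2.1)
                (fun ω => ω.2.1) + δ)) / (M₁ * M₂)) / M₀)
        + 2 * ((∑ k, ∑ z, jointPMF p κ z * testFun (jointPMF p κ) k z ^ 2) / δ ^ 2 / n) := by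
  have hκ1 : ∀ x, ∑ z, κ x z = 1 := fun x => (hκ x).2
  have hPs := jointPMF_mem_stdSimplex hp hκ
  have lX : ∀ x, law (jointPMF p κ) (fun ω => ω.1) x = p x := law_jointPMF_fst p κ hκ1
  have lXA := law_jointPMF_A p κ
  have lXBA := law_jointPMF_BA p κ
  have lXCA := law_jointPMF_CA p κ
  have lAll := law_jointPMF_BCDA p κ
  have hP0 : ∀ z, 0 ≤ jointPMF p κ z := hPs.1
  have hP1 : ∑ z, jointPMF p κ z = 1 := hPs.2
  have hpx : ∀ {x z}, 0 < jointPMF p κ (x, z) → 0 < p x := fun {x z} h =>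
    (hp.1 x).lt_of_ne' fun h0 => h.ne' (by simp [jointPMF, h0])
  have : Nonempty (Fin M₀) := ⟨⟨0, hM₀⟩⟩
  have : Nonempty (Fin M₁) := ⟨⟨0, hM₁⟩⟩
  have : Nonempty (Fin M₂) := ⟨⟨0, hM₂⟩⟩
  set P := jointPMF p κ with hPdef
  -- The two satellites are drawn independently given U, while the joint reconstruction is drawn
  -- from its true conditional law. Thus κ/Q is the density of X against all the other variables
  -- times p(b,c|a)/(p(b|a)p(c|a)), the two logarithms of the last density in `testFun`. All four
  -- ratio bounds are equalities on the support.
  obtain ⟨cb, hcb⟩ := exists_block_codebook (I := Fin M₀) (J := Fin M₁) (K := Fin M₂)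
    (qA := law P fun ω => ω.2.1)
    (qB := condLaw P (fun ω => ω.2.2.1) fun ω => ω.2.1)
    (qC := condLaw P (fun ω => ω.2.2.2.1) fun ω => ω.2.1)
    (qD := fun a b c => condLaw P (fun ω => ω.2.2.2.2)
      (fun ω => (ω.2.2.1, ω.2.2.2.1, ω.2.1)) (b, c, a))
    (law_nonneg hP0 _) (condLaw_nonneg hP0 _ _) (condLaw_nonneg hP0 _ _)
    (fun _ _ _ => condLaw_nonneg hP0 _ _ _) ((sum_law _ _).trans hP1) (sum_condLaw hP1 _ _)
    (sum_condLaw hP1 _ _) (fun _ _ _ => sum_condLaw hP1 _ _ _)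
    hp.1 hp.2 (κ := κ) (fun x z => (hκ x).1 z) hκ1 (testFun P)
    (k₀ := .inl 0) (k₁ := .inl 1) (k₂ := .inl 2) (k₁₂ := .inl 3)
    (fun x a b c d h => by
      have h1 := law_pos hP0 (fun ω => ω.2.1) h
      have h2 := law_pos hP0 (fun ω => (ω.2.2.1, ω.2.1)) h
      have h3 := law_pos hP0 (fun ω => (ω.2.2.2.1, ω.2.1)) h
      have h4 := law_pos hP0 (fun ω => (ω.2.2.1, ω.2.2.2.1, ω.2.1)) h
      have h5 := law_pos hP0 (fun ω => (ω.2.2.1, ω.2.2.2.1, ω.2.2.2.2, ω.2.1)) h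
      have h6 := law_pos hP0 (fun ω => (ω.1, ω.2.2.1, ω.2.2.2.1, ω.2.2.2.2, ω.2.1)) h
      have h7 := law_pos hP0 (fun ω => ω.1) h
      have h8 : law P (fun ω => (ω.2.2.2.2, ω.2.2.1, ω.2.2.2.1, ω.2.1)) (d, b, c, a)
          = law P (fun ω => (ω.2.2.1, ω.2.2.2.1, ω.2.2.2.2, ω.2.1)) (b, c, d, a) :=
        law_eq_of_iff fun ω => by simp only [Prod.mk.injEq]; tauto
      have h9 := hpx h
      rw [condLaw_of_pos h1, condLaw_of_pos h1, condLaw_of_pos h4, h8]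
      simp only [testFun, Matrix.cons_val]
      rw [Real.exp_add, Real.exp_log (by positivity), Real.exp_log (by positivity), lAll, lX]
      refine le_of_eq ?_
      field_simp)
    (fun x a b c d h => by
      have h1 := law_pos hP0 (fun ω => ω.2.1) h
      have h6 := law_pos hP0 (fun ω => (ω.1, ω.2.1)) h
      have h7 := law_pos hP0 (fun ω => ω.1) h
      have h9 := hpx h
      simp only [testFun, Matrix.cons_val]
      rw [Real.exp_log (by positivity), lXA, lX]
      refine le_of_eq ?_
      field_simp)
    (fun x a b c d h => by
      have h1 := law_pos hP0 (fun ω => ω.2.1) h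
      have h2 := law_pos hP0 (fun ω => (ω.2.2.1, ω.2.1)) h
      have h6 := law_pos hP0 (fun ω => (ω.1, ω.2.2.1, ω.2.1)) h
      have h7 := law_pos hP0 (fun ω => ω.1) h
      have h9 := hpx h
      rw [condLaw_of_pos h1]
      simp only [testFun, Matrix.cons_val]
      rw [Real.exp_log (by positivity), lXBA, lX]
      refine le_of_eq ?_
      field_simp)
    (fun x a b c d h => by
      have h1 := law_pos hP0 (fun ω => ω.2.1) h
      have h2 := law_pos hP0 (fun ω => (ω.2.2.2.1, ω.2.1)) h
      have h6 := law_pos hP0 (fun ω => (ω.1, ω.2.2.2.1, ω.2.1)) h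
      have h7 := law_pos hP0 (fun ω => ω.1) h
      have h9 := hpx h
      rw [condLaw_of_pos h1]
      simp only [testFun, Matrix.cons_val]
      rw [Real.exp_log (by positivity), lXCA, lX]
      refine le_of_eq ?_
      field_simp)
    hδ hn
  refine ⟨cb, le_of_eq_of_le (Finset.sum_congr rfl fun x _ => by congr) (hcb.trans (le_of_eq ?_))⟩
  simp only [Fintype.card_fin]
  have i0 : ∑ z, P z * testFun P (.inl 0) z = mutualInfo P (fun ω => ω.1) (fun ω => ω.2.1) :=
    (mutualInfo_eq_sum _ _ _).symm
  have i1 : ∑ z, P z * testFun P (.inl 1) z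
      = mutualInfo P (fun ω => ω.1) (fun ω => (ω.2.2.1, ω.2.1)) :=
    (mutualInfo_eq_sum _ _ _).symm
  have i2 : ∑ z, P z * testFun P (.inl 2) z
      = mutualInfo P (fun ω => ω.1) (fun ω => (ω.2.2.2.1, ω.2.1)) :=
    (mutualInfo_eq_sum _ _ _).symm
  have i3 : ∑ z, P z * testFun P (.inl 3) z
      = mutualInfo P (fun ω => ω.1) (fun ω => (ω.2.2.1, ω.2.2.2.1, ω.2.2.2.2, ω.2.1))
        + condMutualInfo P (fun ω => ω.2.2.1) (fun ω => ω.2.2.2.1) (fun ω => ω.2.1) := by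
    rw [mutualInfo_eq_sum, condMutualInfo_eq_sum, ← Finset.sum_add_distrib]
    exact Finset.sum_congr rfl fun ω _ => mul_add _ _ _
  rw [i0, i1, i2, i3]

/-- Achievability with slack `δ` by superposition coding. -/
lemma achievable_of_mem_rateRegion {p₀ : X → ℝ} (hp₀ : p₀ ∈ stdSimplex ℝ X) {W : X → Y → ℝ}
    (hW : ∀ x, W x ∈ stdSimplex ℝ Y) {κ : X → U × Y × Y × Y → ℝ}
    (hκ : ∀ x, κ x ∈ stdSimplex ℝ (U × Y × Y × Y)) {R₁ R₂ Δ₁ Δ₂ Δ₁₂ : ℝ}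
    (h₁ : jointPMF p₀ (fun x => law (κ x) fun z => z.2.1) ∈ nbhd Δ₁ (jointPMF p₀ W))
    (h₂ : jointPMF p₀ (fun x => law (κ x) fun z => z.2.2.1) ∈ nbhd Δ₂ (jointPMF p₀ W))
    (h₁₂ : jointPMF p₀ (fun x => law (κ x) fun z => z.2.2.2) ∈ nbhd Δ₁₂ (jointPMF p₀ W))
    (hR : (R₁, R₂, Δ₁, Δ₂, Δ₁₂) ∈ rateRegion (jointPMF p₀ κ)) {δ : ℝ} (hδ : 0 < δ) :
    Achievable p₀ W (R₁ + 3 * δ) (R₂ + 3 * δ)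
      (Δ₁ + Fintype.card (X × Y) * δ + δ) (Δ₂ + Fintype.card (X × Y) * δ + δ)
      (Δ₁₂ + Fintype.card (X × Y) * δ + δ) := by
  classical
  obtain ⟨hR₁, hR₂, hR₁₂⟩ := hR
  have hPs := jointPMF_mem_stdSimplex hp₀ hκ
  have hq := jointPMF_mem_stdSimplex hp₀ hW
  have hexp : Filter.Tendsto (fun n : ℕ => (n : ℝ) * δ) Filter.atTop Filter.atTop :=
    tendsto_natCast_atTop_atTop.atTop_mul_const hδ
  set V := (∑ k, ∑ z, jointPMF p₀ κ z * testFun (jointPMF p₀ κ) k z ^ 2) / δ ^ 2 with hV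
  have herr : Filter.Tendsto (fun n : ℕ => 2 * (73 * Real.exp (-(n * δ))) + 2 * (V / n))
      Filter.atTop (nhds 0) := by
    have t1 := (Real.tendsto_exp_neg_atTop_nhds_zero.comp hexp).const_mul 73 |>.const_mul 2
    have t2 := (tendsto_const_div_atTop_nhds_zero_nat V).const_mul 2
    simpa using t1.add t2
  -- The blocklength must make the covering error less than δ and e^{nδ} at least 4, as the codebook
  -- sizes require.
  obtain ⟨N, hN⟩ := Filter.eventually_atTop.1 (((herr.eventually (gt_mem_nhds hδ)).and
    ((Real.tendsto_exp_atTop.comp hexp).eventually_ge_atTop 4)).and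
      (Filter.eventually_gt_atTop 0))
  refine ⟨N, fun n hNn => ?_⟩
  obtain ⟨⟨hsmall, hbig⟩, hn⟩ := hN n hNn.le
  obtain ⟨M₀, M₁, M₂, hM₀, hM₁, hM₂, hM₀₁, hM₀₂, hM⟩ := exists_codebook_sizes (n := n)
    (mutualInfo_nonneg hPs.1 hPs.2 (fun ω => ω.1) fun ω => ω.2.1)
    (mutualInfo_le_mutualInfo_prod hPs.1 hPs.2 (fun ω => ω.1) (fun ω => ω.2.2.1) fun ω => ω.2.1)
    (mutualInfo_le_mutualInfo_prod hPs.1 hPs.2 (fun ω => ω.1) (fun ω => ω.2.2.2.1) fun ω => ω.2.1)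
    hR₁ hR₂ ((add_assoc _ _ _).symm.trans_le hR₁₂) hδ hbig
  obtain ⟨cb, hcb⟩ := exists_superposition_codebook hp₀ hκ hM₀ hM₁ hM₂ hδ hn
  set G : (Fin n → X) → Fin M₀ × Fin M₁ × Fin M₂ → Prop := fun x s =>
    IsTypical (jointPMF p₀ κ) (testFun (jointPMF p₀ κ)) δ fun t =>
      (x t, (cb s.1).1 t, (cb s.1).2.1 s.2.1 t, (cb s.1).2.2.1 s.2.2 t, (cb s.1).2.2.2 s.2 t)
    with hG
  -- The encoder's choice: a typical triple of indices when there is one, an arbitrary triple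
  -- otherwise.
  have hs : ∀ x, ∃ s, (∃ s, G x s) → G x s := by
    intro x
    by_cases h : ∃ s, G x s
    · exact ⟨h.choose, fun _ => h.choose_spec⟩
    · exact ⟨(⟨0, hM₀⟩, ⟨0, hM₁⟩, ⟨0, hM₂⟩), fun h' => absurd h' h⟩
  choose s hs using hs
  obtain ⟨c, hc⟩ := exists_coordinationCode hM₀ hM₁ hM₂ hM₀₁ hM₀₂ (fun i => (cb i).2.1)
    (fun i => (cb i).2.2.1) (fun i => (cb i).2.2.2) s
  have hfail : ∑ x : Fin n → X, (∏ i, p₀ (x i)) * (if ∃ s, G x s then 0 else 1) ≤ δ := by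
    simp only [hG, Prod.exists]
    refine hcb.trans (le_trans ?_ hsmall.le)
    gcongr
  have htv : ∀ (i : Fin 3) (g : U × Y × Y × Y → Y) {Δ : ℝ},
      (∀ z, ![z.2.1, z.2.2.1, z.2.2.2] i = g z) →
      jointPMF p₀ (fun x => law (κ x) g) ∈ nbhd Δ (jointPMF p₀ W) →
      ∀ φ : (Fin n → X) → (Fin n → Y),
      (∀ x t, φ x t = g ((cb (s x).1).1 t, (cb (s x).1).2.1 (s x).2.1 t,
        (cb (s x).1).2.2.1 (s x).2.2 t, (cb (s x).1).2.2.2 (s x).2 t)) →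
      expectedTV p₀ (jointPMF p₀ W) φ ≤ Δ + Fintype.card (X × Y) * δ + δ := by
    intro i g Δ hg hΔ φ hφ
    have hΔ0 : 0 ≤ Δ := (tv_nonneg _ _).trans hΔ.2
    refine expectedTV_le hn hp₀ hq (G := fun x => ∃ s, G x s) (by positivity) (fun x hx => ?_)
      hfail
    have hT := hs x hx
    refine (tv_jointType_le hn (jointPMF p₀ W) (r := jointPMF p₀ fun x => law (κ x) g) hδ.le
      fun z => ?_).trans (add_le_add hΔ.2 le_rfl)
    -- The empirical mean of an indicator test function is a cell of the joint type, and its true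
    -- mean is the corresponding probability; typicality compares the two.
    have hz := hT.2 (.inr (i, z))
    rw [sum_mul_testFun_inr] at hz
    rw [← law_jointPMF_map p₀ κ g z.1 z.2]
    simp only [hφ, ← hg]
    exact hz
  refine ⟨c, ?_, ?_, ?_⟩
  · exact htv 0 (fun z => z.2.1) (fun _ => rfl) h₁ _ fun x t => by rw [(hc x).1]
  · exact htv 1 (fun z => z.2.2.1) (fun _ => rfl) h₂ _ fun x t => by rw [(hc x).2.1]
  · exact htv 2 (fun z => z.2.2.2) (fun _ => rfl) h₁₂ _ fun x t => by rw [(hc x).2.2]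

end Superposition

end MDCoord

theorem theorem2 {X : Type u} {Y : Type v} [Fintype X] [Fintype Y]
    (p₀ : X → ℝ) (hp₀ : p₀ ∈ stdSimplex ℝ X)
    (W : X → Y → ℝ) (hW : ∀ x, W x ∈ stdSimplex ℝ Y) :
    MDCoord.superpositionRegion.{u, v, w} p₀ W ⊆ MDCoord.coordinationRegion p₀ W := by
  rintro ⟨R₁, R₂, Δ₁, Δ₂, Δ₁₂⟩ ⟨U, _, κ, hκ, h₁, h₂, h₁₂, hR⟩
  -- Tuples with slack δ are achievable for every δ > 0 and converge to the given tuple as δ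
  -- decreases to 0, so the given tuple lies in the closure.
  have hlim : Filter.Tendsto (fun δ : ℝ => (R₁ + 3 * δ, R₂ + 3 * δ,
      Δ₁ + Fintype.card (X × Y) * δ + δ, Δ₂ + Fintype.card (X × Y) * δ + δ,
      Δ₁₂ + Fintype.card (X × Y) * δ + δ)) (nhdsWithin 0 (Set.Ioi 0))
      (nhds (R₁, R₂, Δ₁, Δ₂, Δ₁₂)) := by
    refine tendsto_nhdsWithin_of_tendsto_nhds (Continuous.tendsto' (by fun_prop) _ _ (by simp))
  refine mem_closure_of_tendsto hlim ?_
  filter_upwards [self_mem_nhdsWithin] with δ hδ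
  exact MDCoord.achievable_of_mem_rateRegion hp₀ hW hκ h₁ h₂ h₁₂ hR hδ
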